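/- Let $f:\mathbb R^n\to\mathbb R^n$ and $g=[g_1,\dots,g_m]:\mathbb R^n\to\mathbb R^{n\times m}$ be smooth and consider the control-affine system $\dot x=f(x)+g(x)u$, $u\in\mathbb R^m$. Let $H:\mathbb R^n\to\mathbb S^p$ be a smooth function with values in the real symmetric $p\times p$ matrices, let $r\ge 1$, and let $\alpha_1,\dots,\alpha_{r-1}:\mathbb R\to\mathbb R$ be smooth extended class-$\mathcal K$ functions (continuous, strictly increasing, vanishing at $0$), which act on symmetric matrices spectrally. Put $$\Psi_1=H,\qquad \Psi_{i+1}=L_f\Psi_i+\alpha_i(\Psi_i)\quad(1\le i\le r-1),$$ with Lie derivatives taken entrywise, and assume that the input does not enter before level $r$, i.e. $L_{g_j}\Psi_i\equiv 0$ for all $j$ and all $i<r$. Let $\mathcal C_i=\{x:\Psi_i(x)\succeq 0\}$, $\mathcal C=\bigcap_{i=1}^r\mathcal C_i$, and write $\dot\Psi_r(x,u)=L_f\Psi_r(x)+\sum_{j}u_jL_{g_j}\Psi_r(x)$. $H$ has matrix relative degree $r$ at $x$ if $L_{g_j}L_f^kH(x)=0$ for all $j$ and $0\le k\le r-2$, and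 there is $u\in\mathbb R^m$ with $$V_r(x)^\top\Big(\sum_{j=1}^m u_j\,L_{g_j}L_f^{r-1}H(x)\Big)V_r(x)\succ 0,$$ where the columns of $V_r(x)$ form an orthonormal basis of the eigenspace of $\Psi_r(x)$ for its smallest eigenvalue. $H$ is an optimal-decay high-order matrix control barrier function (OD-HOMCBF) if there is an extended class-$\mathcal K$ function $\alpha_r$ such that for every $x\in\mathcal C$ there are $u\in\mathbb R^m$ and $\omega\ge 0$ with $\dot\Psi_r(x,u)\succ-\omega\,\alpha_r(\Psi_r(x))$. A set is forward invariant for a vector field if every solution on an interval $[0,T)$ that starts in the set stays in it on $[0,T)$. **Theorem.** Suppose that $H$ has matrix relative degree $r$ at every point of some open neighborhood of $\{x\in\mathcal C:\Psi_r(x)\not\succ 0\}$ (the part of the boundary of $\mathcal C$ on which $\Psi_r$ is not positive definite, the boundary of $\mathcal C_r$ being understood as the set where the smallest eigenvalue of $\Psi_r$ is $0$). Then $H$ is an OD-HOMCBF. Consequently there is a continuous feedback $k:\mathbb R^n\to\mathbb R^m$ such that $\mathcal C$ is forward invariant for $\dot x=f(x)+g(x)k(x)$. Such a feedback is given by the OD-HOMCBF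 semidefinite-program filter: for every extended class-$\mathcal K$ function $\alpha_r$ as in the definition of an OD-HOMCBF, every continuous $k_{\rm nom}:\mathbb R^n\to\mathbb R^m$, every $c>0$ and every $\theta_d\in\mathbb R$, there are an open set $W\supseteq\mathcal C$ and a continuous $k:\mathbb R^n\to\mathbb R^m$ such that for each $x\in W$ the problem $$\min_{u\in\mathbb R^m,\ \omega\ge 0}\ \|u-k_{\rm nom}(x)\|^2+c(\omega-\theta_d)^2\quad\text{s.t.}\quad \dot\Psi_r(x,u)\succeq-\omega\,\alpha_r(\Psi_r(x)),\quad \omega\ge\theta_d$$ has a unique minimizer, its $u$-component is $k(x)$, and $\mathcal C$ is forward invariant for $\dot x=f(x)+g(x)k(x)$. -/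

import Mathlib

open scoped ContDiff Matrix

namespace MatrixCBF

noncomputable section

variable {n m p : ℕ}

/-- The state space `ℝⁿ` (and the input space `ℝᵐ`) with the Euclidean norm. -/
abbrev E (n : ℕ) : Type := EuclideanSpace ℝ (Fin n)

/-- A real square matrix of size `p`. -/
abbrev Mat (p : ℕ) : Type := Matrix (Fin p) (Fin p) ℝ

/-- Extended class-`𝒦` functions: continuous, strictly increasing, vanishing at `0`. -/
structure IsExtClassK (a : ℝ → ℝ) : Prop where
  continuous : Continuous a
  strictMono : StrictMono a
  map_zero : a 0 = 0

/-- Smoothness of a matrix-valued function, entry by entry. -/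
def SmoothMat {q s : ℕ} (A : E n → Matrix (Fin q) (Fin s) ℝ) : Prop :=
  ∀ i j, ContDiff ℝ ∞ (fun x => A x i j)

/-- The `j`-th column of the control matrix `g`, as a vector field. -/
def col (g : E n → Matrix (Fin n) (Fin m) ℝ) (j : Fin m) : E n → E n :=
  fun x => WithLp.toLp 2 (fun i => g x i j)

/-- Lie derivative of a matrix-valued function along a vector field, entry by entry. -/
def lieDeriv (v : E n → E n) (A : E n → Mat p) : E n → Mat p :=
  fun x => Matrix.of fun i j => fderiv ℝ (fun y => A y i j) x (v x)

/-- The sequence `Ψ₁ = H`, `Ψ_{i+1} = L_f Ψ_i + α_i(Ψ_i)` for `i ≥ 1`, where the scalar function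
`α_i` acts spectrally on symmetric matrices. The value at index `0` is never used. -/
def Psi (f : E n → E n) (H : E n → Mat p) (α : ℕ → ℝ → ℝ) : ℕ → E n → Mat p
  | 0 => H
  | 1 => H
  | i + 2 => fun x =>
      lieDeriv f (Psi f H α (i + 1)) x + cfc (α (i + 1)) (Psi f H α (i + 1) x)

/-- The set `𝒞_i` of states where `Ψ_i` is positive semidefinite. -/
def safeSet (f : E n → E n) (H : E n → Mat p) (α : ℕ → ℝ → ℝ) (i : ℕ) : Set (E n) :=
  {x | (Psi f H α i x).PosSemidef}

/-- The intersection `𝒞₁ ∩ ⋯ ∩ 𝒞_r`. -/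
def safeInter (f : E n → E n) (H : E n → Mat p) (α : ℕ → ℝ → ℝ) (r : ℕ) : Set (E n) :=
  {x | ∀ i, 1 ≤ i → i ≤ r → x ∈ safeSet f H α i}

/-- The part of the boundary of `𝒞₁ ∩ ⋯ ∩ 𝒞_r` where `Ψ_r` is not positive definite, that is, the
points of the intersection at which the smallest eigenvalue of `Ψ_r` vanishes. -/
def criticalBoundary (f : E n → E n) (H : E n → Mat p) (α : ℕ → ℝ → ℝ) (r : ℕ) : Set (E n) :=
  {x ∈ safeInter f H α r | ¬ (Psi f H α r x).PosDef}

/-- The derivative `L_f A(x) + ∑ⱼ uⱼ L_{gⱼ} A(x)` of `A` along the control-affine system. -/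
def dotMat (f : E n → E n) (g : E n → Matrix (Fin n) (Fin m) ℝ) (A : E n → Mat p)
    (x : E n) (u : E m) : Mat p :=
  lieDeriv f A x + ∑ j, u j • lieDeriv (col g j) A x

/-- The smallest eigenvalue of a symmetric matrix. -/
def lambdaMin (A : Mat p) : ℝ := sInf (spectrum ℝ A)

/-- The columns of `V` form an orthonormal basis of the eigenspace of `A` associated with its
smallest eigenvalue. -/
def IsMinEigenbasis {q : ℕ} (A : Mat p) (V : Matrix (Fin p) (Fin q) ℝ) : Prop :=
  Vᵀ * V = 1 ∧
    Set.range (fun c : Fin q → ℝ => V *ᵥ c) = {w : Fin p → ℝ | A *ᵥ w = lambdaMin A • w}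

/-- `H` has matrix relative degree `r` at `x` (with `V` a matrix of orthonormal eigenvectors
spanning the minimal eigenspace of `Ψ_r(x)`; the condition does not depend on its choice). -/
def HasMatrixRelDegAt (f : E n → E n) (g : E n → Matrix (Fin n) (Fin m) ℝ) (H : E n → Mat p)
    (α : ℕ → ℝ → ℝ) (r : ℕ) (x : E n) : Prop :=
  (∀ (j : Fin m) (k : ℕ), k + 2 ≤ r → lieDeriv (col g j) ((lieDeriv f)^[k] H) x = 0) ∧
    ∃ (q : ℕ) (V : Matrix (Fin p) (Fin q) ℝ), IsMinEigenbasis (Psi f H α r x) V ∧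
      ∃ u : E m,
        (Vᵀ * (∑ j, u j • lieDeriv (col g j) ((lieDeriv f)^[r - 1] H) x) * V).PosDef

/-- The optimal-decay barrier condition with terminal function `a = α_r`: at each point of
`𝒞₁ ∩ ⋯ ∩ 𝒞_r` there are `u` and `w ≥ 0` with `Ψ̇_r(x, u) ≻ -w a(Ψ_r(x))`. -/
def ODCondition (f : E n → E n) (g : E n → Matrix (Fin n) (Fin m) ℝ) (H : E n → Mat p)
    (α : ℕ → ℝ → ℝ) (r : ℕ) (a : ℝ → ℝ) : Prop :=
  ∀ x ∈ safeInter f H α r, ∃ (u : E m) (w : ℝ), 0 ≤ w ∧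
    (dotMat f g (Psi f H α r) x u - -(w • cfc a (Psi f H α r x))).PosDef

/-- `H` is an optimal-decay high-order matrix control barrier function. -/
def IsODHOMCBF (f : E n → E n) (g : E n → Matrix (Fin n) (Fin m) ℝ) (H : E n → Mat p)
    (α : ℕ → ℝ → ℝ) (r : ℕ) : Prop :=
  ∃ a : ℝ → ℝ, IsExtClassK a ∧ ODCondition f g H α r a

/-- The closed-loop vector field `f(x) + g(x) k(x)`. -/
def closedLoop (f : E n → E n) (g : E n → Matrix (Fin n) (Fin m) ℝ) (k : E n → E m) :
    E n → E n :=
  fun x => f x + WithLp.toLp 2 (g x *ᵥ (k x).ofLp)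

/-- `S` is forward invariant for `ẋ = F(x)`: every solution, on any interval `[0, T)`, that starts
in `S` stays in `S` throughout that interval. -/
def ForwardInvariant (F : E n → E n) (S : Set (E n)) : Prop :=
  ∀ (T : ℝ) (x : ℝ → E n),
    (∀ t ∈ Set.Ico 0 T, HasDerivWithinAt x (F (x t)) (Set.Ico 0 T) t) →
      x 0 ∈ S → ∀ t ∈ Set.Ico 0 T, x t ∈ S

/-- Feasible pairs `(u, w)` of the safety filter at `x`:
`w ≥ 0`, `w ≥ θ` and `Ψ̇_r(x, u) ⪰ -w a(Ψ_r(x))`. -/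
def sdpFeasible (f : E n → E n) (g : E n → Matrix (Fin n) (Fin m) ℝ) (H : E n → Mat p)
    (α : ℕ → ℝ → ℝ) (r : ℕ) (a : ℝ → ℝ) (θ : ℝ) (x : E n) : Set (E m × ℝ) :=
  {z | 0 ≤ z.2 ∧ θ ≤ z.2 ∧
    (dotMat f g (Psi f H α r) x z.1 - -(z.2 • cfc a (Psi f H α r x))).PosSemidef}

/-- The cost `‖u - k_nom(x)‖² + c (w - θ)²` of the safety filter at `x`. -/
def sdpCost (knom : E n → E m) (c θ : ℝ) (x : E n) (z : E m × ℝ) : ℝ :=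
  ‖z.1 - knom x‖ ^ 2 + c * (z.2 - θ) ^ 2

/-- `(u, w)` is a minimizer of the safety filter at `x`. -/
def IsSDPSolution (f : E n → E n) (g : E n → Matrix (Fin n) (Fin m) ℝ) (H : E n → Mat p)
    (α : ℕ → ℝ → ℝ) (r : ℕ) (a : ℝ → ℝ) (knom : E n → E m) (c θ : ℝ) (x : E n)
    (z : E m × ℝ) : Prop :=
  z ∈ sdpFeasible f g H α r a θ x ∧ IsMinOn (sdpCost knom c θ x) (sdpFeasible f g H α r a θ x) z

end

end MatrixCBF

/-! At a critical boundary point `Ψ_r` is positive semidefinite and singular, so its smallest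
eigenvalue is `0` and the minimal eigenspace is its kernel. Since `L_f^(r-1) H` equals `Ψ_r` plus a
smooth function of `Ψ_1, …, Ψ_{r-1}`, whose derivatives along the `g_j` vanish, the relative degree
condition really concerns `L_{g_j} Ψ_r` (`lieDeriv_col_Psi_eq`). A large multiple of the input it
provides makes `Ψ̇_r` positive on that kernel, and Finsler's lemma (`exists_posDef_add_smul`) then
yields `ω ≥ 0` with `Ψ̇_r + ω Ψ_r ≻ 0`. Hence the identity serves as `α_r` (`ODCondition_id`).

The smooth function above exists because the spectral action of a smooth scalar function is smooth
on symmetric matrices (`contDiff_spectralMap`); the proof bootstraps an integral formula for `f(A) -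
f(B)`.

For the filter, strict feasibility is an open condition that holds on `𝒞`. A strongly convex cost
gives a unique minimizer, a strictly feasible point gives its continuity, and Tietze's theorem
extends the feedback from a smaller neighborhood of `𝒞` to the whole space.

Invariance rests on the sign of `α_r`: at an eigenvalue `μ < 0` of `Ψ_r` one has `-ω α_r(μ) ≥ 0`, so
in a neighborhood of `𝒞` the derivative of `Ψ_r` is nonnegative along eigenvectors with negative
eigenvalue, and no eigenvalue can become negative (`posSemidef_of_deriv_nonneg`). Then `Ψ_r ⪰ 0`
gives `Ψ_{r-1} ⪰ 0` in the same way, and so on down to `Ψ_1`. Neither uniqueness of solutions nor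
any regularity of `ω` in time is needed. -/

namespace MatrixCBF

/-! ### Smooth dependence of integrals on a parameter -/

section ParametricIntegral

open Filter Topology Set

variable {X : Type} [NormedAddCommGroup X] [NormedSpace ℝ X] [ProperSpace X]

theorem hasFDerivAt_intervalIntegral_of_contDiff {Y : Type} [NormedAddCommGroup Y]
    [NormedSpace ℝ Y] [CompleteSpace Y] {Φ : X × ℝ → Y} (hΦ : ContDiff ℝ 1 Φ) (x : X) :
    HasFDerivAt (fun x => ∫ t in (0 : ℝ)..1, Φ (x, t))
      (∫ t in (0 : ℝ)..1, (fderiv ℝ Φ (x, t)).comp (ContinuousLinearMap.inl ℝ X ℝ)) x := by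
  have hcont : Continuous (fun z : X × ℝ =>
      (fderiv ℝ Φ z).comp (ContinuousLinearMap.inl ℝ X ℝ)) :=
    (hΦ.continuous_fderiv one_ne_zero).clm_comp continuous_const
  obtain ⟨C, hC⟩ := ((isCompact_closedBall x 1).prod
    (isCompact_Icc (a := (0 : ℝ)) (b := 1))).exists_bound_of_continuousOn hcont.continuousOn
  refine intervalIntegral.hasFDerivAt_integral_of_dominated_of_fderiv_le
    (F := fun x t => Φ (x, t))
    (F' := fun x t => (fderiv ℝ Φ (x, t)).comp (ContinuousLinearMap.inl ℝ X ℝ))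
    (bound := fun _ => C) (Metric.closedBall_mem_nhds x one_pos) ?_ ?_ ?_ ?_ ?_ ?_
  · exact Eventually.of_forall fun y =>
      (hΦ.continuous.comp (by fun_prop : Continuous fun t : ℝ => (y, t))).aestronglyMeasurable
  · exact (hΦ.continuous.comp
      (by fun_prop : Continuous fun t : ℝ => (x, t))).intervalIntegrable _ _
  · exact (hcont.comp (by fun_prop : Continuous fun t : ℝ => (x, t))).aestronglyMeasurable
  · refine Eventually.of_forall fun t ht y hy => hC (y, t) ⟨hy, ?_⟩
    rw [uIoc_of_le zero_le_one] at ht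
    exact ⟨ht.1.le, ht.2⟩
  · exact intervalIntegrable_const
  · refine Eventually.of_forall fun t _ y _ => ?_
    have h1 : HasFDerivAt Φ (fderiv ℝ Φ (y, t)) (y, t) :=
      (hΦ.differentiable one_ne_zero (y, t)).hasFDerivAt
    have h2 : HasFDerivAt (fun y : X => (y, t)) (ContinuousLinearMap.inl ℝ X ℝ) y :=
      hasFDerivAt_prodMk_left y t
    exact h1.comp y h2

/-- The target `Y` is quantified inside the induction because differentiating under the integral
sign replaces it by a space of linear operators. -/
theorem contDiff_intervalIntegral (k : ℕ) :
    ∀ {Y : Type} [NormedAddCommGroup Y] [NormedSpace ℝ Y] [CompleteSpace Y] {Φ : X × ℝ → Y},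
      ContDiff ℝ k Φ → ContDiff ℝ k (fun x => ∫ t in (0 : ℝ)..1, Φ (x, t)) := by
  induction k with
  | zero =>
    intro Y _ _ _ Φ hΦ
    exact contDiff_zero.2 (intervalIntegral.continuous_parametric_intervalIntegral_of_continuous'
      (f := fun x t => Φ (x, t)) hΦ.continuous 0 1)
  | succ k ih =>
    intro Y _ _ _ Φ hΦ
    push_cast at hΦ ⊢
    refine contDiff_succ_iff_hasFDerivAt.2 ⟨_, ih
      (Φ := fun z => (fderiv ℝ Φ z).comp (ContinuousLinearMap.inl ℝ X ℝ)) ?_, fun x =>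
      hasFDerivAt_intervalIntegral_of_contDiff (hΦ.of_le le_add_self) x⟩
    exact (hΦ.fderiv_right le_rfl).clm_comp contDiff_const

end ParametricIntegral

/-! ### Smoothness of the spectral action of a scalar function -/

section SpectralCalculus

open scoped Kronecker
open Filter Topology Matrix

variable {ι : Type} [Fintype ι] [DecidableEq ι]

/-- The symmetric part of a square matrix. -/
noncomputable def symPart {κ : Type} (A : Matrix κ κ ℝ) : Matrix κ κ ℝ := (1 / 2 : ℝ) • (A + Aᵀ)

theorem symPart_isSymm {κ : Type} (A : Matrix κ κ ℝ) : (symPart A).IsSymm := by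
  simp [symPart, Matrix.IsSymm, add_comm]

theorem symPart_of_isSymm {κ : Type} {A : Matrix κ κ ℝ} (hA : A.IsSymm) : symPart A = A := by
  rw [symPart, hA.eq, ← two_smul ℝ A, smul_smul]
  norm_num

theorem exists_orthogonal_diagonalization {A : Matrix ι ι ℝ} (hA : A.IsSymm) :
    ∃ (U : Matrix ι ι ℝ) (d : ι → ℝ), Uᵀ * U = 1 ∧ U * Uᵀ = 1 ∧ A = U * diagonal d * Uᵀ ∧
      ∀ f : ℝ → ℝ, cfc f A = U * diagonal (f ∘ d) * Uᵀ := by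
  have hH : A.IsHermitian := by
    rw [Matrix.IsHermitian, conjTranspose_eq_transpose_of_trivial]; exact hA
  refine ⟨hH.eigenvectorUnitary, hH.eigenvalues, ?_, ?_, ?_, fun f => ?_⟩
  · have := Unitary.coe_star_mul_self hH.eigenvectorUnitary
    rwa [star_eq_conjTranspose, conjTranspose_eq_transpose_of_trivial] at this
  · have := Unitary.coe_mul_star_self hH.eigenvectorUnitary
    rwa [Unitary.coe_star, star_eq_conjTranspose, conjTranspose_eq_transpose_of_trivial] at this
  · have := hH.spectral_theorem
    rwa [Unitary.conjStarAlgAut_apply, star_eq_conjTranspose,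
      conjTranspose_eq_transpose_of_trivial] at this
  · rw [hH.cfc_eq, Matrix.IsHermitian.cfc, Unitary.conjStarAlgAut_apply, star_eq_conjTranspose,
      conjTranspose_eq_transpose_of_trivial]
    rfl

/-- Two diagonalizations are compared through the overlap matrix `Uᵀ * V`: a nonzero entry forces
the two eigenvalues to coincide. This is what makes the functional calculus independent of the
diagonalization. -/
theorem conj_diagonal_eq_iff {U V : Matrix ι ι ℝ} {d e : ι → ℝ} (hU : Uᵀ * U = 1)
    (hU' : U * Uᵀ = 1) (hV : Vᵀ * V = 1) (hV' : V * Vᵀ = 1) :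
    U * diagonal d * Uᵀ = V * diagonal e * Vᵀ ↔
      ∀ i j, d i * (Uᵀ * V) i j = (Uᵀ * V) i j * e j := by
  have key : U * diagonal d * Uᵀ = V * diagonal e * Vᵀ ↔
      diagonal d * (Uᵀ * V) = (Uᵀ * V) * diagonal e := by
    constructor
    · intro h
      calc diagonal d * (Uᵀ * V) = (Uᵀ * U) * diagonal d * Uᵀ * V := by
            rw [hU, Matrix.one_mul, Matrix.mul_assoc]
        _ = Uᵀ * (U * diagonal d * Uᵀ) * V := by simp only [Matrix.mul_assoc]
        _ = (Uᵀ * V) * diagonal e * (Vᵀ * V) := by rw [h]; simp only [Matrix.mul_assoc]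
        _ = _ := by rw [hV, Matrix.mul_one]
    · intro h
      calc U * diagonal d * Uᵀ = U * (diagonal d * (Uᵀ * V)) * Vᵀ := by
            simp only [Matrix.mul_assoc, hV', Matrix.mul_one]
        _ = (U * Uᵀ) * V * diagonal e * Vᵀ := by rw [h]; simp only [Matrix.mul_assoc]
        _ = _ := by rw [hU', Matrix.one_mul]
  rw [key, ← Matrix.ext_iff]
  simp only [diagonal_mul, mul_diagonal]

theorem isSymm_conj_diagonal (U : Matrix ι ι ℝ) (d : ι → ℝ) : (U * diagonal d * Uᵀ).IsSymm := by
  simp [Matrix.IsSymm, Matrix.transpose_mul, Matrix.mul_assoc]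

theorem cfc_conj_diagonal (f : ℝ → ℝ) {U : Matrix ι ι ℝ} {d : ι → ℝ} (hU : Uᵀ * U = 1)
    (hU' : U * Uᵀ = 1) : cfc f (U * diagonal d * Uᵀ) = U * diagonal (f ∘ d) * Uᵀ := by
  obtain ⟨V, e, hV, hV', hA, hf⟩ :=
    exists_orthogonal_diagonalization (isSymm_conj_diagonal U d)
  rw [hf, eq_comm, conj_diagonal_eq_iff hU hU' hV hV']
  rw [conj_diagonal_eq_iff hU hU' hV hV'] at hA
  intro i j
  by_cases h : (Uᵀ * V) i j = 0
  · simp [h]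
  · have : d i = e j := mul_right_cancel₀ h ((hA i j).trans (mul_comm _ _))
    simp [this, mul_comm]

theorem isSymm_cfc (f : ℝ → ℝ) (A : Matrix ι ι ℝ) : (cfc f A).IsSymm := by
  have : IsSelfAdjoint (cfc f A) := cfc_predicate f A
  rw [IsSelfAdjoint, star_eq_conjTranspose, conjTranspose_eq_transpose_of_trivial] at this
  exact this

/-- The spectral action of `f` on the symmetric part of a matrix. -/
noncomputable def spectralMap (f : ℝ → ℝ) (A : Matrix ι ι ℝ) : Matrix ι ι ℝ := cfc f (symPart A)

theorem abs_entry_le_one_of_orthogonal {U : Matrix ι ι ℝ} (hU' : U * Uᵀ = 1) (i j : ι) :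
    ‖U i j‖ ≤ 1 := by
  have h : ∑ k, U i k * U i k = 1 := by
    have := congrFun (congrFun hU' i) i
    simpa [Matrix.mul_apply] using this
  have h2 : U i j * U i j ≤ 1 := by
    rw [← h]
    exact Finset.single_le_sum (f := fun k => U i k * U i k)
      (fun k _ => mul_self_nonneg _) (Finset.mem_univ j)
  rw [Real.norm_eq_abs]
  exact abs_le_one_iff_mul_self_le_one.2 h2

theorem continuous_symPart {κ : Type} :
    Continuous (symPart : Matrix κ κ ℝ → Matrix κ κ ℝ) := by
  unfold symPart
  have h : Continuous (fun A : Matrix κ κ ℝ => A) := continuous_id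
  exact (h.add h.matrix_transpose).const_smul (1 / 2 : ℝ)

/-- Eigenvectors need not depend continuously on the matrix, but orthogonal matrices form a bounded
set. Along any ultrafilter the eigenvector matrices converge to an orthogonal matrix, which
diagonalizes the limit. -/
theorem continuous_spectralMap {f : ℝ → ℝ} (hf : Continuous f) :
    Continuous (spectralMap f : Matrix ι ι ℝ → Matrix ι ι ℝ) := by
  choose U d hU hU' hA hcfc using
    fun A : Matrix ι ι ℝ => exists_orthogonal_diagonalization (symPart_isSymm A)
  rw [continuous_iff_ultrafilter]
  intro A₀ F hF
  have hK : IsCompact {M : Matrix ι ι ℝ | ∀ i j, M i j ∈ Set.Icc (-1 : ℝ) 1} := by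
    have h : IsCompact (Set.univ.pi fun _ : ι => Set.univ.pi fun _ : ι => Set.Icc (-1 : ℝ) 1) :=
      isCompact_univ_pi fun _ => isCompact_univ_pi fun _ => isCompact_Icc
    have h' : {M : Matrix ι ι ℝ | ∀ i j, M i j ∈ Set.Icc (-1 : ℝ) 1} =
        Set.univ.pi fun _ : ι => Set.univ.pi fun _ : ι => Set.Icc (-1 : ℝ) 1 :=
      Set.ext fun M => ⟨fun hM i _ j _ => hM i j, fun hM i j => hM i trivial j trivial⟩
    rw [h']
    exact h
  have hmem : ∀ A, U A ∈ {M : Matrix ι ι ℝ | ∀ i j, M i j ∈ Set.Icc (-1 : ℝ) 1} := fun A i j =>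
    abs_le.1 (abs_entry_le_one_of_orthogonal (hU' A) i j)
  obtain ⟨V, -, hV⟩ := hK.ultrafilter_le_nhds (F.map U)
    (by rw [Ultrafilter.coe_map, le_principal_iff]; exact mem_map.2 (univ_mem' hmem))
  have hUV : Tendsto U F (𝓝 V) := hV
  have hUVt : Tendsto (fun A => (U A)ᵀ) F (𝓝 Vᵀ) :=
    (continuous_id.matrix_transpose.tendsto V).comp hUV
  have hmul : ∀ {a b : Matrix ι ι ℝ → Matrix ι ι ℝ} {x y : Matrix ι ι ℝ},
      Tendsto a F (𝓝 x) → Tendsto b F (𝓝 y) → Tendsto (fun A => a A * b A) F (𝓝 (x * y)) :=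
    fun {a b x y} h1 h2 =>
      ((continuous_fst.matrix_mul continuous_snd).tendsto (x, y)).comp (h1.prodMk_nhds h2)
  have hS : Tendsto symPart (F : Filter (Matrix ι ι ℝ)) (𝓝 (symPart A₀)) :=
    (continuous_symPart.tendsto A₀).mono_left hF
  have hV1 : Vᵀ * V = 1 :=
    tendsto_nhds_unique (hmul hUVt hUV) (by simp only [hU]; exact tendsto_const_nhds)
  have hV2 : V * Vᵀ = 1 :=
    tendsto_nhds_unique (hmul hUV hUVt) (by simp only [hU']; exact tendsto_const_nhds)
  set d₀ : ι → ℝ := fun k => (Vᵀ * symPart A₀ * V) k k with hd₀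
  -- The eigenvalues are recovered from the eigenvectors, so their convergence comes for free.
  have hdiag : ∀ A, diagonal (d A) = (U A)ᵀ * symPart A * U A := fun A => by
    conv_rhs => rw [hA A]
    calc diagonal (d A) = ((U A)ᵀ * U A) * diagonal (d A) * ((U A)ᵀ * U A) := by
          rw [hU, Matrix.one_mul, Matrix.mul_one]
      _ = _ := by simp only [Matrix.mul_assoc]
  have hd : ∀ k, Tendsto (fun A => d A k) F (𝓝 (d₀ k)) := fun k => by
    have h1 := hmul (hmul hUVt hS) hUV
    have h2 := ((continuous_id.matrix_elem k k).tendsto _).comp h1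
    refine h2.congr fun A => ?_
    simp [← hdiag]
  have hdg : ∀ {h : ℝ → ℝ}, Continuous h →
      Tendsto (fun A => U A * diagonal (h ∘ d A) * (U A)ᵀ) F
        (𝓝 (V * diagonal (h ∘ d₀) * Vᵀ)) := fun {h} hh => by
    refine hmul (hmul hUV ?_) hUVt
    have h1 : Tendsto (fun A => h ∘ d A) F (𝓝 (h ∘ d₀)) :=
      tendsto_pi_nhds.2 fun k => (hh.tendsto _).comp (hd k)
    exact ((continuous_id.matrix_diagonal).tendsto _).comp h1
  have hA0 : symPart A₀ = V * diagonal d₀ * Vᵀ := by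
    refine tendsto_nhds_unique hS ((hdg continuous_id).congr fun A => ?_)
    rw [Function.id_comp, ← hA]
  have : spectralMap f A₀ = V * diagonal (f ∘ d₀) * Vᵀ := by
    rw [spectralMap, hA0, cfc_conj_diagonal f hV1 hV2]
  rw [this]
  exact (hdg hf).congr fun A => (hcfc A f).symm

open scoped Matrix.Norms.L2Operator

/-- Carathéodory's criterion: a slope operator that is continuous at the base point has the
derivative as its value there. -/
theorem hasFDerivAt_of_sub_eq {X Y : Type} [NormedAddCommGroup X] [NormedSpace ℝ X]
    [NormedAddCommGroup Y] [NormedSpace ℝ Y] {F : X → Y} {Q : X → X →L[ℝ] Y} {b : X}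
    (hQ : ContinuousAt Q b) (h : ∀ a, F a - F b = Q a (a - b)) : HasFDerivAt F (Q b) b := by
  refine HasFDerivAt.of_isLittleO ?_
  have h1 : (fun a => F a - F b - Q b (a - b)) = fun a => (Q a - Q b) (a - b) := by
    funext a
    rw [h, _root_.sub_apply]
  rw [h1]
  have h2 : Tendsto (fun a => ‖Q a - Q b‖) (𝓝 b) (𝓝 0) := by
    have := (hQ.sub continuousAt_const).norm (a := b) (f := fun a => Q a - Q b)
    simpa [ContinuousAt] using this
  refine Asymptotics.isLittleO_iff.2 fun c hc => ?_
  filter_upwards [h2.eventually (gt_mem_nhds hc)] with a ha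
  exact ((Q a - Q b).le_opNorm _).trans (by gcongr)

/-- The segment joining left multiplication by `A` to right multiplication by `B`, as matrices
acting on vectorized matrices (`A` and `B` being replaced by their symmetric parts). -/
noncomputable def mulSegment (A B : Matrix ι ι ℝ) (t : ℝ) : Matrix (ι × ι) (ι × ι) ℝ :=
  (1 - t) • ((1 : Matrix ι ι ℝ) ⊗ₖ symPart A) + t • (symPart B ⊗ₖ (1 : Matrix ι ι ℝ))

/-- Left and right multiplications commute, so `V ⊗ₖ U` diagonalizes both ends of the segment at
once, whether or not `A` and `B` commute. -/
theorem mulSegment_eq {A B U V : Matrix ι ι ℝ} {d e : ι → ℝ} (hU' : U * Uᵀ = 1)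
    (hV' : V * Vᵀ = 1) (hA : symPart A = U * diagonal d * Uᵀ)
    (hB : symPart B = V * diagonal e * Vᵀ) (t : ℝ) :
    mulSegment A B t = (V ⊗ₖ U) * diagonal (fun q : ι × ι => (1 - t) * d q.2 + t * e q.1) *
      (V ⊗ₖ U)ᵀ := by
  have h1 : (1 : Matrix ι ι ℝ) ⊗ₖ symPart A =
      (V ⊗ₖ U) * ((1 : Matrix ι ι ℝ) ⊗ₖ diagonal d) * (V ⊗ₖ U)ᵀ := by
    rw [← kroneckerMap_transpose, ← mul_kronecker_mul, ← mul_kronecker_mul, ← hA, Matrix.mul_one,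
      hV']
  have h2 : symPart B ⊗ₖ (1 : Matrix ι ι ℝ) =
      (V ⊗ₖ U) * (diagonal e ⊗ₖ (1 : Matrix ι ι ℝ)) * (V ⊗ₖ U)ᵀ := by
    rw [← kroneckerMap_transpose, ← mul_kronecker_mul, ← mul_kronecker_mul, ← hB, Matrix.mul_one,
      hU']
  have h3 : diagonal (fun q : ι × ι => (1 - t) * d q.2 + t * e q.1) =
      (1 - t) • ((1 : Matrix ι ι ℝ) ⊗ₖ diagonal d) + t • (diagonal e ⊗ₖ (1 : Matrix ι ι ℝ)) := by
    rw [← diagonal_one, diagonal_kronecker_diagonal, diagonal_kronecker_diagonal,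
      ← diagonal_smul, ← diagonal_smul, diagonal_add]
    congr 1
    funext q
    simp
  rw [mulSegment, h1, h2, h3, Matrix.mul_add, Matrix.add_mul]
  simp only [Matrix.mul_smul, Matrix.smul_mul]

theorem integral_deriv_segment {f : ℝ → ℝ} (hf : ContDiff ℝ 1 f) (d e : ℝ) :
    (∫ t in (0 : ℝ)..1, deriv f ((1 - t) * d + t * e) * (d - e)) = f d - f e := by
  have hseg : ∀ t : ℝ, HasDerivAt (fun t : ℝ => (1 - t) * d + t * e) (e - d) t := fun t => by
    have := (((hasDerivAt_id t).const_sub 1).mul_const d).add ((hasDerivAt_id t).mul_const e)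
    exact this.congr_deriv (by ring)
  have h : ∀ t ∈ Set.uIcc (0 : ℝ) 1, HasDerivAt (fun t : ℝ => -f ((1 - t) * d + t * e))
      (deriv f ((1 - t) * d + t * e) * (d - e)) t := fun t _ => by
    have h1 := ((hf.differentiable one_ne_zero _).hasDerivAt.comp t (hseg t)).neg
    exact h1.congr_deriv (by ring)
  rw [intervalIntegral.integral_eq_sub_of_hasDerivAt h]
  · simp; ring
  · refine Continuous.intervalIntegrable ?_ _ _
    exact ((hf.continuous_deriv le_rfl).comp (by fun_prop)).mul continuous_const

theorem isSymm_mulSegment {ι : Type} [DecidableEq ι] (A B : Matrix ι ι ℝ) (t : ℝ) : (mulSegment A B t).IsSymm := by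
  simp only [Matrix.IsSymm, mulSegment, transpose_add, transpose_smul, ← kroneckerMap_transpose,
    transpose_one, (symPart_isSymm A).eq, (symPart_isSymm B).eq]

/-- Averaged derivative of `f` between left multiplication by `A` and right multiplication
by `B`. -/
noncomputable def dividedDiff (f : ℝ → ℝ) (A B : Matrix ι ι ℝ) : Matrix (ι × ι) (ι × ι) ℝ :=
  ∫ t in (0 : ℝ)..1, spectralMap (deriv f) (mulSegment A B t)

theorem contDiff_entry {κ κ' : Type} [Fintype κ] [DecidableEq κ] [Fintype κ'] [DecidableEq κ']
    {X : Type} [NormedAddCommGroup X] [NormedSpace ℝ X] {k : ℕ∞ω} {F : X → Matrix κ κ' ℝ} :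
    ContDiff ℝ k F ↔ ∀ i j, ContDiff ℝ k (fun x => F x i j) := by
  constructor
  · intro h i j
    exact (LinearMap.toContinuousLinearMap (Matrix.entryLinearMap ℝ ℝ i j)).contDiff.comp h
  · intro h
    have h1 : F = fun x => ∑ i, ∑ j, F x i j • Matrix.single i j (1 : ℝ) := by
      funext x
      conv_lhs => rw [Matrix.matrix_eq_sum_single (F x)]
      simp
    rw [h1]
    exact ContDiff.sum fun i _ => ContDiff.sum fun j _ => (h i j).smul contDiff_const

theorem contDiff_symPart {κ : Type} [Fintype κ] [DecidableEq κ] {X : Type} [NormedAddCommGroup X]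
    [NormedSpace ℝ X] {k : ℕ∞ω} {F : X → Matrix κ κ ℝ} (hF : ContDiff ℝ k F) :
    ContDiff ℝ k (fun x => symPart (F x)) := by
  rw [contDiff_entry] at hF ⊢
  intro i j
  simp only [symPart, Matrix.smul_apply, Matrix.add_apply, transpose_apply]
  exact ((hF i j).add (hF j i)).const_smul (1 / 2 : ℝ)

theorem contDiff_mulSegment {X : Type} [NormedAddCommGroup X] [NormedSpace ℝ X] {k : ℕ∞ω}
    {F G : X → Matrix ι ι ℝ} {t : X → ℝ} (hF : ContDiff ℝ k F) (hG : ContDiff ℝ k G)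
    (ht : ContDiff ℝ k t) : ContDiff ℝ k (fun x => mulSegment (F x) (G x) (t x)) := by
  have hF' := contDiff_entry.1 (contDiff_symPart hF)
  have hG' := contDiff_entry.1 (contDiff_symPart hG)
  refine contDiff_entry.2 fun i j => ?_
  simp only [mulSegment, Matrix.smul_apply, Matrix.add_apply, kroneckerMap_apply, smul_eq_mul]
  exact ((contDiff_const.sub ht).mul (contDiff_const.mul (hF' _ _))).add
    (ht.mul ((hG' _ _).mul contDiff_const))

theorem continuous_dividedDiff {f : ℝ → ℝ} (hf : Continuous (deriv f)) (B : Matrix ι ι ℝ) :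
    Continuous (fun A => dividedDiff f A B) := by
  refine intervalIntegral.continuous_parametric_intervalIntegral_of_continuous'
    (f := fun A t => spectralMap (deriv f) (mulSegment A B t)) ?_ 0 1
  exact (continuous_spectralMap hf).comp
    (contDiff_mulSegment (k := 0) contDiff_fst contDiff_const contDiff_snd).continuous

/-- In the eigenbases of `A` and `B`, the operator `dividedDiff f A B` multiplies the `(i, j)` entry
by `∫ f'((1-t) dᵢ + t eⱼ) dt`, while `A - B` contributes the factor `dᵢ - eⱼ`; the product is `f dᵢ
- f eⱼ`. The integral form avoids any case distinction for equal eigenvalues. -/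
theorem vec_spectralMap_sub {f : ℝ → ℝ} (hf : ContDiff ℝ 1 f) (A B : Matrix ι ι ℝ) :
    (spectralMap f A - spectralMap f B).vec = dividedDiff f A B *ᵥ (symPart (A - B)).vec := by
  obtain ⟨U, d, hU, hU', hA, hfA⟩ := exists_orthogonal_diagonalization (symPart_isSymm A)
  obtain ⟨V, e, hV, hV', hB, hfB⟩ := exists_orthogonal_diagonalization (symPart_isSymm B)
  set W := V ⊗ₖ U with hW
  have hW1 : Wᵀ * W = 1 := by
    rw [hW, ← kroneckerMap_transpose, ← mul_kronecker_mul, hU, hV, one_kronecker_one]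
  have hW2 : W * Wᵀ = 1 := by
    rw [hW, ← kroneckerMap_transpose, ← mul_kronecker_mul, hU', hV', one_kronecker_one]
  have hcfc : ∀ t, spectralMap (deriv f) (mulSegment A B t) =
      W * diagonal (fun q : ι × ι => deriv f ((1 - t) * d q.2 + t * e q.1)) * Wᵀ := fun t => by
    rw [spectralMap, symPart_of_isSymm (isSymm_mulSegment A B t), mulSegment_eq hU' hV' hA hB,
      cfc_conj_diagonal _ hW1 hW2]
    rfl
  have hsub : symPart (A - B) = symPart A - symPart B := by
    simp only [symPart, transpose_sub, ← smul_sub]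
    congr 1
    abel
  have hz : Wᵀ *ᵥ (symPart (A - B)).vec =
      fun q : ι × ι => (d q.2 - e q.1) * (Uᵀ * V) q.2 q.1 := by
    rw [hW, ← kroneckerMap_transpose, kronecker_mulVec_vec, transpose_transpose, hsub]
    have : Uᵀ * (symPart A - symPart B) * V = diagonal d * (Uᵀ * V) - (Uᵀ * V) * diagonal e := by
      rw [hA, hB, Matrix.mul_sub, Matrix.sub_mul]
      congr 1
      · calc _ = (Uᵀ * U) * diagonal d * (Uᵀ * V) := by simp only [Matrix.mul_assoc]
          _ = _ := by rw [hU, Matrix.one_mul]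
      · calc _ = (Uᵀ * V) * diagonal e * (Vᵀ * V) := by simp only [Matrix.mul_assoc]
          _ = _ := by rw [hV, Matrix.mul_one]
    rw [this]
    funext q
    simp only [vec, Matrix.sub_apply, diagonal_mul, mul_diagonal]
    ring
  have hcont : Continuous (fun t : ℝ => spectralMap (deriv f) (mulSegment A B t)) :=
    (continuous_spectralMap (hf.continuous_deriv le_rfl)).comp
      (contDiff_mulSegment (k := 0) contDiff_const contDiff_const contDiff_id).continuous
  let L : Matrix (ι × ι) (ι × ι) ℝ →L[ℝ] (ι × ι → ℝ) := LinearMap.toContinuousLinearMap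
    ((Matrix.mulVecBilin ℝ ℝ).flip ((symPart (A - B)).vec))
  have hL : ∀ G, L G = G *ᵥ (symPart (A - B)).vec := fun G => rfl
  have h1 : dividedDiff f A B *ᵥ (symPart (A - B)).vec =
      ∫ t in (0 : ℝ)..1, W *ᵥ (fun q : ι × ι =>
        (deriv f ((1 - t) * d q.2 + t * e q.1) * (d q.2 - e q.1)) * (Uᵀ * V) q.2 q.1) := by
    rw [← hL, dividedDiff, ← L.intervalIntegral_comp_comm (hcont.intervalIntegrable _ _)]
    congr 1
    funext t
    rw [hL, hcfc, ← mulVec_mulVec, hz, ← mulVec_mulVec]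
    congr 1
    funext q
    rw [mulVec_diagonal]
    ring
  let LW : (ι × ι → ℝ) →L[ℝ] (ι × ι → ℝ) := LinearMap.toContinuousLinearMap (Matrix.mulVecLin W)
  have hLW : ∀ z, LW z = W *ᵥ z := fun z => rfl
  have hc2 : ∀ q : ι × ι, Continuous (fun t : ℝ =>
      (deriv f ((1 - t) * d q.2 + t * e q.1) * (d q.2 - e q.1)) * (Uᵀ * V) q.2 q.1) := fun q =>
    (((hf.continuous_deriv le_rfl).comp (by fun_prop)).mul continuous_const).mul continuous_const
  have h2 : (∫ t in (0 : ℝ)..1, W *ᵥ (fun q : ι × ι =>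
        (deriv f ((1 - t) * d q.2 + t * e q.1) * (d q.2 - e q.1)) * (Uᵀ * V) q.2 q.1)) =
      W *ᵥ (fun q : ι × ι => (f (d q.2) - f (e q.1)) * (Uᵀ * V) q.2 q.1) := by
    simp only [← hLW]
    rw [LW.intervalIntegral_comp_comm ((continuous_pi hc2).intervalIntegrable _ _)]
    congr 1
    funext q
    rw [← integral_deriv_segment hf, ← intervalIntegral.integral_mul_const]
    exact ((ContinuousLinearMap.proj (R := ℝ)
      (φ := fun _ : ι × ι => ℝ) q).intervalIntegral_comp_comm ((continuous_pi hc2).intervalIntegrable 0 1)).symm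
  rw [h1, h2]
  have h3 : (fun q : ι × ι => (f (d q.2) - f (e q.1)) * (Uᵀ * V) q.2 q.1) =
      (diagonal (f ∘ d) * (Uᵀ * V) - (Uᵀ * V) * diagonal (f ∘ e)).vec := by
    funext q
    simp only [vec, Matrix.sub_apply, diagonal_mul, mul_diagonal, Function.comp]
    ring
  rw [h3, hW, kronecker_mulVec_vec, spectralMap, spectralMap, hfA, hfB, Matrix.mul_sub,
    Matrix.sub_mul]
  congr 2
  · calc _ = U * diagonal (f ∘ d) * Uᵀ * (V * Vᵀ) := by rw [hV', Matrix.mul_one]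
      _ = _ := by simp only [Matrix.mul_assoc]
  · calc _ = (U * Uᵀ) * (V * diagonal (f ∘ e) * Vᵀ) := by rw [hU', Matrix.one_mul]
      _ = _ := by simp only [Matrix.mul_assoc]

/-- A matrix acting on vectorized matrices, viewed as a linear operator on matrices precomposed
with the symmetric part. -/
noncomputable def symAction (ι : Type) [Fintype ι] [DecidableEq ι] :
    Matrix (ι × ι) (ι × ι) ℝ →L[ℝ] (Matrix ι ι ℝ →L[ℝ] Matrix ι ι ℝ) :=
  -- `{ toFun` below reads off position `(j, i)` because `vec` stacks columns.
  LinearMap.toContinuousLinearMap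
    { toFun := fun G => LinearMap.toContinuousLinearMap
        { toFun := fun Z => Matrix.of fun i j => (G *ᵥ (symPart Z).vec) (j, i)
          map_add' := fun Y Z => by
            have : symPart (Y + Z) = symPart Y + symPart Z := by
              simp only [symPart, transpose_add, ← smul_add]
              congr 1
              abel
            ext i j
            simp [this, vec_add, mulVec_add]
          map_smul' := fun c Z => by
            have : symPart (c • Z) = c • symPart Z := by
              simp only [symPart, transpose_smul, ← smul_add, smul_comm c]
            ext i j
            simp [this, vec_smul, mulVec_smul] }
      map_add' := fun G G' => by
        ext Z i j
        simp [add_mulVec]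
      map_smul' := fun c G => by
        ext Z i j
        simp [smul_mulVec] }

theorem symAction_apply (G : Matrix (ι × ι) (ι × ι) ℝ) (Z : Matrix ι ι ℝ) :
    symAction ι G Z = Matrix.of fun i j => (G *ᵥ (symPart Z).vec) (j, i) := rfl

theorem hasFDerivAt_spectralMap {f : ℝ → ℝ} (hf : ContDiff ℝ 1 f) (B : Matrix ι ι ℝ) :
    HasFDerivAt (spectralMap f) (symAction ι (dividedDiff f B B)) B := by
  refine hasFDerivAt_of_sub_eq (Q := fun A => symAction ι (dividedDiff f A B)) ?_ fun A => ?_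
  · exact ((symAction ι).continuous.comp
      (continuous_dividedDiff (hf.continuous_deriv le_rfl) B)).continuousAt
  · ext i j
    rw [symAction_apply, ← vec_spectralMap_sub hf]
    rfl

/-- The derivative is an integral of the spectral action of `deriv f` on matrices indexed by `ι ×
ι`, so the induction must range over all index types and all smooth functions. -/
theorem contDiff_nat_spectralMap (k : ℕ) :
    ∀ {ι : Type} [Fintype ι] [DecidableEq ι] {f : ℝ → ℝ}, ContDiff ℝ ∞ f →
      ContDiff ℝ k (spectralMap f : Matrix ι ι ℝ → Matrix ι ι ℝ) := by
  induction k with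
  | zero =>
    intro ι _ _ f hf
    exact contDiff_zero.2 (continuous_spectralMap hf.continuous)
  | succ k ih =>
    intro ι _ _ f hf
    push_cast
    refine contDiff_succ_iff_hasFDerivAt.2 ⟨_, ?_, fun B =>
      hasFDerivAt_spectralMap (hf.of_le (by exact_mod_cast le_top)) B⟩
    have hf' : ContDiff ℝ ∞ (deriv f) := (contDiff_infty_iff_deriv.1 hf).2
    have h1 : ContDiff ℝ k (fun A : Matrix ι ι ℝ => dividedDiff f A A) :=
      contDiff_intervalIntegral k
        (Φ := fun z : Matrix ι ι ℝ × ℝ => spectralMap (deriv f) (mulSegment z.1 z.1 z.2))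
        ((ih hf').comp (contDiff_mulSegment contDiff_fst contDiff_fst contDiff_snd))
    refine contDiff_clm_apply_iff.2 fun Z => contDiff_entry.2 fun i j => ?_
    simp only [symAction_apply, Matrix.of_apply, mulVec, dotProduct]
    exact ContDiff.sum fun q _ => (contDiff_entry.1 h1 _ _).mul contDiff_const

theorem contDiff_spectralMap {f : ℝ → ℝ} (hf : ContDiff ℝ ∞ f) :
    ContDiff ℝ ∞ (spectralMap f : Matrix ι ι ℝ → Matrix ι ι ℝ) :=
  contDiff_infty.2 fun k => contDiff_nat_spectralMap k hf

end SpectralCalculus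

/-! ### Lie derivatives and the sequence `Ψ` -/

section LieDerivatives

open scoped Matrix.Norms.L2Operator
open Filter Topology Matrix

variable {n m p : ℕ}

theorem smoothMat_iff {q s : ℕ} {A : E n → Matrix (Fin q) (Fin s) ℝ} :
    SmoothMat A ↔ ContDiff ℝ ∞ A := contDiff_entry.symm

theorem lieDeriv_eq_fderiv {A : E n → Mat p} {x : E n} (hA : DifferentiableAt ℝ A x)
    (v : E n → E n) : lieDeriv v A x = fderiv ℝ A x (v x) := by
  ext i j
  have h : HasFDerivAt (fun y => A y i j)
      ((LinearMap.toContinuousLinearMap (Matrix.entryLinearMap ℝ ℝ i j)).comp (fderiv ℝ A x)) x :=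
    (LinearMap.toContinuousLinearMap (Matrix.entryLinearMap ℝ ℝ i j)).hasFDerivAt.comp x
      hA.hasFDerivAt
  rw [lieDeriv, of_apply, h.fderiv]
  rfl

theorem contDiff_lieDeriv {v : E n → E n} {A : E n → Mat p} (hv : ContDiff ℝ ∞ v)
    (hA : ContDiff ℝ ∞ A) : ContDiff ℝ ∞ (lieDeriv v A) := by
  have h : lieDeriv v A = fun x => fderiv ℝ A x (v x) :=
    funext fun x => lieDeriv_eq_fderiv (hA.differentiable (by simp) x) v
  rw [h]
  exact (hA.fderiv_right (by simp)).clm_apply hv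

theorem contDiff_col {g : E n → Matrix (Fin n) (Fin m) ℝ} (hg : SmoothMat g) (j : Fin m) :
    ContDiff ℝ ∞ (col g j) :=
  contDiff_euclidean.2 fun i => hg i j

theorem isSymm_lieDeriv (v : E n → E n) {A : E n → Mat p} (hA : ∀ x, (A x).IsSymm) (x : E n) :
    (lieDeriv v A x).IsSymm := by
  ext i j
  simp only [lieDeriv, transpose_apply, of_apply]
  congr 2
  funext y
  exact (hA y).apply i j

theorem isSymm_Psi (f : E n → E n) {H : E n → Mat p} (hsymm : ∀ x, (H x).IsSymm)
    (α : ℕ → ℝ → ℝ) (i : ℕ) : ∀ x, (Psi f H α i x).IsSymm := by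
  induction i using Nat.twoStepInduction with
  | zero => exact hsymm
  | one => exact hsymm
  | more i _ ih =>
    intro x
    exact (isSymm_lieDeriv f ih x).add (isSymm_cfc _ _)

theorem Psi_add_two (f : E n → E n) {H : E n → Mat p} (hsymm : ∀ x, (H x).IsSymm)
    (α : ℕ → ℝ → ℝ) (i : ℕ) (x : E n) : Psi f H α (i + 2) x =
      lieDeriv f (Psi f H α (i + 1)) x + spectralMap (α (i + 1)) (Psi f H α (i + 1) x) := by
  rw [spectralMap, symPart_of_isSymm (isSymm_Psi f hsymm α _ x)]
  rfl

theorem contDiff_Psi {f : E n → E n} (hf : ContDiff ℝ ∞ f) {H : E n → Mat p}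
    (hH : SmoothMat H) (hsymm : ∀ x, (H x).IsSymm) {α : ℕ → ℝ → ℝ} {r : ℕ}
    (hα : ∀ i, 1 ≤ i → i < r → ContDiff ℝ ∞ (α i)) (i : ℕ) (hi : i + 1 ≤ r) :
    ContDiff ℝ ∞ (Psi f H α (i + 1)) := by
  induction i with
  | zero => exact smoothMat_iff.1 hH
  | succ i ih =>
    have h := ih (by omega)
    have h1 : Psi f H α (i + 1 + 1) = fun x => lieDeriv f (Psi f H α (i + 1)) x +
        spectralMap (α (i + 1)) (Psi f H α (i + 1) x) := funext (Psi_add_two f hsymm α i)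
    rw [h1]
    exact (contDiff_lieDeriv hf h).add
      ((contDiff_spectralMap (hα (i + 1) (by omega) (by omega))).comp h)

theorem lieDeriv_add_comp {k : ℕ} {A : E n → Mat p} {B : Fin k → E n → Mat p}
    {Φ : (Fin k → Mat p) → Mat p} (hA : ContDiff ℝ ∞ A) (hB : ∀ i, ContDiff ℝ ∞ (B i))
    (hΦ : ContDiff ℝ ∞ Φ) (v : E n → E n) (x : E n) :
    lieDeriv v (fun x => A x + Φ (fun i => B i x)) x =
      lieDeriv v A x + fderiv ℝ Φ (fun i => B i x) (fun i => lieDeriv v (B i) x) := by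
  have hA' := (hA.differentiable (by simp) x).hasFDerivAt
  have hB' : ∀ i, HasFDerivAt (B i) (fderiv ℝ (B i) x) x := fun i =>
    ((hB i).differentiable (by simp) x).hasFDerivAt
  have hΦ' := (hΦ.differentiable (by simp) (fun i => B i x)).hasFDerivAt
  have h := hA'.add (hΦ'.comp x (hasFDerivAt_pi.2 hB'))
  have h' : HasFDerivAt (fun x => A x + Φ (fun i => B i x)) _ x := h
  rw [lieDeriv_eq_fderiv h'.differentiableAt, h'.fderiv, lieDeriv_eq_fderiv hA'.differentiableAt,
    _root_.add_apply, ContinuousLinearMap.comp_apply]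
  congr 2
  funext i
  rw [lieDeriv_eq_fderiv (hB' i).differentiableAt]
  rfl

/-- The iterated Lie derivatives of `H` differ from the sequence `Ψ` by smooth functions of the
earlier terms. -/
theorem exists_iterate_lieDeriv_eq {f : E n → E n} (hf : ContDiff ℝ ∞ f) {H : E n → Mat p}
    (hH : SmoothMat H) (hsymm : ∀ x, (H x).IsSymm) {α : ℕ → ℝ → ℝ} {r : ℕ}
    (hα : ∀ i, 1 ≤ i → i < r → ContDiff ℝ ∞ (α i)) (k : ℕ) (hk : k + 1 ≤ r) :
    ∃ Φ : (Fin k → Mat p) → Mat p, ContDiff ℝ ∞ Φ ∧ ∀ x, (lieDeriv f)^[k] H x =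
      Psi f H α (k + 1) x + Φ (fun i => Psi f H α (i + 1) x) := by
  induction k with
  | zero => exact ⟨fun _ => 0, contDiff_const, fun x => (add_zero _).symm⟩
  | succ k ih =>
    obtain ⟨Φ, hΦ, h⟩ := ih (by omega)
    have hΨ : ∀ i : ℕ, i ≤ k → ContDiff ℝ ∞ (Psi f H α (i + 1)) := fun i hi =>
      contDiff_Psi hf hH hsymm hα i (by omega)
    -- The witness is the chain rule with every `L_f Ψ_i` replaced by `Ψ_{i+1} - α_i(Ψ_i)`. The
    -- coordinate `y i` stands for `Ψ_{i+1}`, as `Fin` starts at `0`.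
    refine ⟨fun y => fderiv ℝ Φ (fun i => y i.castSucc)
      (fun i => y i.succ - spectralMap (α (i + 1)) (y i.castSucc)) -
        spectralMap (α (k + 1)) (y (Fin.last k)), ?_, fun x => ?_⟩
    · refine ContDiff.sub (ContDiff.clm_apply ?_ ?_) ?_
      · exact (hΦ.fderiv_right (m := ∞) (by simp)).comp
          (contDiff_pi.2 fun i => contDiff_apply ℝ _ _)
      · exact contDiff_pi.2 fun i => (contDiff_apply ℝ _ _).sub
          ((contDiff_spectralMap (hα _ (by omega) (by omega))).comp (contDiff_apply ℝ _ _))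
      · exact (contDiff_spectralMap (hα _ (by omega) (by omega))).comp (contDiff_apply ℝ _ _)
    · rw [Function.iterate_succ_apply', funext h, lieDeriv_add_comp (hΨ k le_rfl)
        (B := fun i : Fin k => Psi f H α (i + 1)) (fun i => hΨ i i.2.le) hΦ]
      have h1 : ∀ i, lieDeriv f (Psi f H α (i + 1)) x =
          Psi f H α (i + 2) x - spectralMap (α (i + 1)) (Psi f H α (i + 1) x) := fun i => by
        rw [Psi_add_two f hsymm, add_sub_cancel_right]
      simp only [h1, Fin.val_last, Fin.val_castSucc, Fin.val_succ]
      abel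

/-- The correction separating `L_f^(r-1) H` from `Ψ_r` depends only on earlier terms, whose
derivatives along the input fields vanish; the chain rule kills it. -/
theorem lieDeriv_col_Psi_eq {f : E n → E n} (hf : ContDiff ℝ ∞ f)
    {g : E n → Matrix (Fin n) (Fin m) ℝ} {H : E n → Mat p}
    (hH : SmoothMat H) (hsymm : ∀ x, (H x).IsSymm) {α : ℕ → ℝ → ℝ} {r : ℕ} (hr : 1 ≤ r)
    (hα : ∀ i, 1 ≤ i → i < r → ContDiff ℝ ∞ (α i))
    (hlevel : ∀ i, 1 ≤ i → i < r → ∀ (j : Fin m) (x : E n),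
      lieDeriv (col g j) (Psi f H α i) x = 0) (j : Fin m) (x : E n) :
    lieDeriv (col g j) ((lieDeriv f)^[r - 1] H) x = lieDeriv (col g j) (Psi f H α r) x := by
  obtain ⟨k, rfl⟩ : ∃ k, r = k + 1 := ⟨r - 1, by omega⟩
  obtain ⟨Φ, hΦ, h⟩ := exists_iterate_lieDeriv_eq hf hH hsymm hα k le_rfl
  rw [Nat.add_sub_cancel, funext h, lieDeriv_add_comp (contDiff_Psi hf hH hsymm hα k le_rfl)
    (B := fun i : Fin k => Psi f H α (i + 1))
    (fun i => contDiff_Psi hf hH hsymm hα i (by omega)) hΦ]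
  have h0 : (fun i : Fin k => lieDeriv (col g j) (Psi f H α (i + 1)) x) = 0 :=
    funext fun i => hlevel _ (by omega) (by omega) j x
  rw [h0, map_zero, add_zero]

theorem hasDerivWithinAt_comp_closedLoop {f : E n → E n} {g : E n → Matrix (Fin n) (Fin m) ℝ}
    {k : E n → E m} {A : E n → Mat p} (hA : Differentiable ℝ A) {x : ℝ → E n} {s : Set ℝ} {t : ℝ}
    (hx : HasDerivWithinAt x (closedLoop f g k (x t)) s t) :
    HasDerivWithinAt (fun t => A (x t)) (dotMat f g A (x t) (k (x t))) s t := by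
  have h := (hA (x t)).hasFDerivAt.comp_hasDerivWithinAt t hx
  have h1 : closedLoop f g k (x t) = f (x t) + ∑ j, k (x t) j • col g j (x t) := by
    rw [closedLoop]
    congr 1
    ext i
    simp [col, mulVec, dotProduct, mul_comm]
  have h2 : dotMat f g A (x t) (k (x t)) = fderiv ℝ A (x t) (closedLoop f g k (x t)) := by
    simp only [h1, dotMat, lieDeriv_eq_fderiv (hA (x t)), map_add, map_sum, map_smul]
  rw [h2]
  exact h

theorem hasDerivWithinAt_quadForm_closedLoop {f : E n → E n}
    {g : E n → Matrix (Fin n) (Fin m) ℝ} {k : E n → E m} {A : E n → Mat p} (hA : SmoothMat A)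
    {x : ℝ → E n} {s : Set ℝ} {t : ℝ} (hx : HasDerivWithinAt x (closedLoop f g k (x t)) s t)
    (v : Fin p → ℝ) : HasDerivWithinAt (fun t => v ⬝ᵥ (A (x t) *ᵥ v))
      (v ⬝ᵥ (dotMat f g A (x t) (k (x t)) *ᵥ v)) s t := by
  let L : Mat p →L[ℝ] ℝ := LinearMap.toContinuousLinearMap
    { toFun := fun B => v ⬝ᵥ (B *ᵥ v)
      map_add' := fun B C => by rw [add_mulVec, dotProduct_add]
      map_smul' := fun c B => by rw [smul_mulVec, dotProduct_smul]; rfl }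
  exact L.hasFDerivAt.comp_hasDerivWithinAt t
    (hasDerivWithinAt_comp_closedLoop ((smoothMat_iff.1 hA).differentiable (by simp)) hx)

end LieDerivatives

/-! ### Definite matrices, Finsler's lemma and curves of symmetric matrices -/

section Definiteness

open Filter Topology Matrix

variable {p : ℕ}

theorem posDef_iff_isSymm {A : Mat p} :
    A.PosDef ↔ A.IsSymm ∧ ∀ v : Fin p → ℝ, v ≠ 0 → 0 < v ⬝ᵥ (A *ᵥ v) := by
  rw [posDef_iff_dotProduct_mulVec, IsHermitian, conjTranspose_eq_transpose_of_trivial]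
  simp only [star_trivial, Matrix.IsSymm]

theorem posSemidef_iff_isSymm {A : Mat p} :
    A.PosSemidef ↔ A.IsSymm ∧ ∀ v : Fin p → ℝ, 0 ≤ v ⬝ᵥ (A *ᵥ v) := by
  rw [posSemidef_iff_dotProduct_mulVec, IsHermitian, conjTranspose_eq_transpose_of_trivial]
  simp only [star_trivial, Matrix.IsSymm]

theorem mulVec_eq_zero_of_posSemidef {A : Mat p} (hA : A.PosSemidef) {v : Fin p → ℝ}
    (hv : v ⬝ᵥ (A *ᵥ v) = 0) : A *ᵥ v = 0 := by
  have := hA.dotProduct_mulVec_zero_iff v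
  rw [star_trivial] at this
  exact this.1 hv

theorem quadForm_smul (A : Mat p) (c : ℝ) (v : Fin p → ℝ) :
    (c • v) ⬝ᵥ (A *ᵥ (c • v)) = c ^ 2 * (v ⬝ᵥ (A *ᵥ v)) := by
  rw [mulVec_smul, dotProduct_smul, smul_dotProduct, smul_eq_mul, smul_eq_mul]
  ring

theorem exists_sphere_smul {v : Fin p → ℝ} (hv : v ≠ 0) :
    ∃ w ∈ Metric.sphere (0 : Fin p → ℝ) 1, ∃ c : ℝ, c ≠ 0 ∧ v = c • w := by
  have h : ‖v‖ ≠ 0 := norm_ne_zero_iff.2 hv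
  refine ⟨‖v‖⁻¹ • v, ?_, ‖v‖, h, ?_⟩
  · rw [mem_sphere_zero_iff_norm, norm_smul, norm_inv, norm_norm, inv_mul_cancel₀ h]
  · rw [smul_smul, mul_inv_cancel₀ h, one_smul]

theorem ne_zero_of_mem_unit_sphere {v : Fin p → ℝ} (hv : v ∈ Metric.sphere (0 : Fin p → ℝ) 1) :
    v ≠ 0 := by
  rintro rfl
  simp at hv

theorem posDef_iff_sphere {A : Mat p} (hA : A.IsSymm) :
    A.PosDef ↔ ∀ v ∈ Metric.sphere (0 : Fin p → ℝ) 1, 0 < v ⬝ᵥ (A *ᵥ v) := by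
  refine ⟨fun h v hv => (posDef_iff_isSymm.1 h).2 v (ne_zero_of_mem_unit_sphere hv),
    fun h => posDef_iff_isSymm.2 ⟨hA, fun v hv => ?_⟩⟩
  obtain ⟨w, hw, c, hc, rfl⟩ := exists_sphere_smul hv
  rw [quadForm_smul]
  exact mul_pos (by positivity) (h w hw)

theorem continuous_quadForm {X : Type*} [TopologicalSpace X] {A : X → Mat p}
    {v : X → Fin p → ℝ} (hA : Continuous A) (hv : Continuous v) :
    Continuous (fun x => v x ⬝ᵥ (A x *ᵥ v x)) :=
  hv.dotProduct (hA.matrix_mulVec hv)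

theorem isOpen_setOf_posDef {X : Type*} [TopologicalSpace X] {A : X → Mat p}
    (hA : Continuous A) (hs : ∀ x, (A x).IsSymm) : IsOpen {x | (A x).PosDef} := by
  rw [isOpen_iff_mem_nhds]
  intro x hx
  have hx' := (posDef_iff_sphere (hs x)).1 hx
  have h := (isCompact_sphere (0 : Fin p → ℝ) 1).eventually_forall_of_forall_eventually (x₀ := x)
    (P := fun x v => 0 < v ⬝ᵥ (A x *ᵥ v)) fun v hv =>
      ((continuous_quadForm (hA.comp continuous_fst) continuous_snd).tendsto
        (x, v)).eventually (lt_mem_nhds (hx' v hv))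
  filter_upwards [h] with y hy
  exact (posDef_iff_sphere (hs y)).2 hy

theorem isClosed_setOf_posSemidef : IsClosed {A : Mat p | A.PosSemidef} := by
  have : {A : Mat p | A.PosSemidef} =
      {A | Aᵀ = A} ∩ ⋂ v : Fin p → ℝ, {A | 0 ≤ v ⬝ᵥ (A *ᵥ v)} := by
    ext A
    simp [posSemidef_iff_isSymm, Matrix.IsSymm]
  rw [this]
  refine (isClosed_eq continuous_id.matrix_transpose continuous_id).inter
    (isClosed_iInter fun v => isClosed_le continuous_const ?_)
  exact continuous_quadForm continuous_id continuous_const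

/-- **Finsler's lemma**: if `Q` is positive on the kernel of the positive semidefinite matrix `A`,
then `Q + w A` is positive definite for some `w ≥ 0`. -/
theorem exists_posDef_add_smul {A Q : Mat p} (hA : A.PosSemidef) (hQ : Q.IsSymm)
    (h : ∀ v : Fin p → ℝ, v ≠ 0 → A *ᵥ v = 0 → 0 < v ⬝ᵥ (Q *ᵥ v)) :
    ∃ w : ℝ, 0 ≤ w ∧ (Q + w • A).PosDef := by
  by_contra! hcon
  have hA' := posSemidef_iff_isSymm.1 hA
  -- Unit vectors at which `Q + N A` fails to be positive form a decreasing sequence of nonempty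
  -- compact sets; a common point must lie in the kernel of `A`, where `Q` is positive.
  set K : ℕ → Set (Fin p → ℝ) := fun N =>
    Metric.sphere 0 1 ∩ {v | v ⬝ᵥ (Q *ᵥ v) + N * (v ⬝ᵥ (A *ᵥ v)) ≤ 0} with hK
  have hclosed : ∀ N : ℕ, IsClosed {v : Fin p → ℝ | v ⬝ᵥ (Q *ᵥ v) + (N : ℝ) * (v ⬝ᵥ (A *ᵥ v)) ≤ 0} :=
    fun N => isClosed_le ((continuous_quadForm continuous_const continuous_id).add
      (continuous_const.mul (continuous_quadForm continuous_const continuous_id))) continuous_const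
  have hne : (⋂ N, K N).Nonempty := by
    refine IsCompact.nonempty_iInter_of_sequence_nonempty_isCompact_isClosed K ?_ ?_ ?_ ?_
    · rintro N v ⟨hv, hv'⟩
      refine ⟨hv, ?_⟩
      have := hA'.2 v
      simp only [Set.mem_ofPred_eq] at hv' ⊢
      push_cast at hv'
      linarith
    · intro N
      have hs : (Q + (N : ℝ) • A).IsSymm := hQ.add (hA'.1.smul _)
      have := hcon N N.cast_nonneg
      rw [posDef_iff_sphere hs] at this
      push Not at this
      obtain ⟨v, hv, hv'⟩ := this
      refine ⟨v, hv, ?_⟩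
      rwa [add_mulVec, dotProduct_add, smul_mulVec, dotProduct_smul, smul_eq_mul] at hv'
    · exact (isCompact_sphere _ _).inter_right (hclosed 0)
    · exact fun N => Metric.isClosed_sphere.inter (hclosed N)
  obtain ⟨v, hv⟩ := hne
  have hv' : ∀ N : ℕ, v ⬝ᵥ (Q *ᵥ v) + N * (v ⬝ᵥ (A *ᵥ v)) ≤ 0 := fun N =>
    (Set.mem_iInter.1 hv N).2
  have h0 : v ⬝ᵥ (A *ᵥ v) = 0 := by
    refine le_antisymm ?_ (hA'.2 v)
    by_contra! hpos
    obtain ⟨N, hN⟩ := exists_nat_gt (-(v ⬝ᵥ (Q *ᵥ v)) / (v ⬝ᵥ (A *ᵥ v)))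
    rw [div_lt_iff₀ hpos] at hN
    linarith [hv' N]
  have h1 := h v (ne_zero_of_mem_unit_sphere (Set.mem_iInter.1 hv 0).1)
    (mulVec_eq_zero_of_posSemidef hA h0)
  have h2 := hv' 0
  rw [h0] at h2
  linarith

theorem exists_mulVec_eq_zero_of_not_posDef {A : Mat p} (hA : A.PosSemidef) (hA' : ¬ A.PosDef) :
    ∃ v : Fin p → ℝ, v ≠ 0 ∧ A *ᵥ v = 0 := by
  have hs := posSemidef_iff_isSymm.1 hA
  rw [posDef_iff_isSymm] at hA'
  push Not at hA'
  obtain ⟨v, hv, hv'⟩ := hA' hs.1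
  exact ⟨v, hv, mulVec_eq_zero_of_posSemidef hA (le_antisymm hv' (hs.2 v))⟩

theorem lambdaMin_eq_zero {A : Mat p} (hA : A.PosSemidef) (hA' : ¬ A.PosDef) :
    lambdaMin A = 0 := by
  obtain ⟨v, hv, hAv⟩ := exists_mulVec_eq_zero_of_not_posDef hA hA'
  refine IsLeast.csInf_eq ⟨?_, fun μ hμ => ?_⟩
  · rw [spectrum.zero_mem_iff]
    intro hu
    rw [← hA.posDef_iff_isUnit] at hu
    exact hA' hu
  · exact (posSemidef_iff_isHermitian_and_spectrum_nonneg.1 hA).2 hμ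

theorem cfc_mulVec_of_eigenvector (f : ℝ → ℝ) {A : Mat p} (hA : A.IsSymm) {v : Fin p → ℝ} {μ : ℝ}
    (hv : A *ᵥ v = μ • v) : cfc f A *ᵥ v = f μ • v := by
  obtain ⟨U, d, hU, hU', hd, hf⟩ := exists_orthogonal_diagonalization hA
  have h1 : diagonal d *ᵥ (Uᵀ *ᵥ v) = μ • (Uᵀ *ᵥ v) := by
    calc diagonal d *ᵥ (Uᵀ *ᵥ v) = (Uᵀ * U) *ᵥ (diagonal d *ᵥ (Uᵀ *ᵥ v)) := by
          rw [hU, one_mulVec]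
      _ = Uᵀ *ᵥ ((U * diagonal d * Uᵀ) *ᵥ v) := by simp only [mulVec_mulVec, Matrix.mul_assoc]
      _ = _ := by rw [← hd, hv, mulVec_smul]
  have h2 : diagonal (f ∘ d) *ᵥ (Uᵀ *ᵥ v) = f μ • (Uᵀ *ᵥ v) := by
    funext i
    have h3 := congrFun h1 i
    rw [mulVec_diagonal, Pi.smul_apply, smul_eq_mul] at h3 ⊢
    by_cases h : (Uᵀ *ᵥ v) i = 0
    · simp [h]
    · rw [Function.comp_apply, mul_right_cancel₀ h h3]
  rw [hf, ← mulVec_mulVec, ← mulVec_mulVec, h2, mulVec_smul, mulVec_mulVec, hU', one_mulVec]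

/-- If at each negative eigenvalue the derivative is nonnegative along the eigenvectors, then a
curve of symmetric matrices that starts positive semidefinite remains so. -/
theorem posSemidef_of_deriv_nonneg {M M' : ℝ → Mat p} {t₀ t₁ : ℝ} (hs : ∀ t, (M t).IsSymm)
    (hcont : ContinuousOn M (Set.Icc t₀ t₁))
    (hderiv : ∀ t ∈ Set.Ioc t₀ t₁, ∀ v : Fin p → ℝ, HasDerivWithinAt
      (fun t => v ⬝ᵥ (M t *ᵥ v)) (v ⬝ᵥ (M' t *ᵥ v)) (Set.Iic t) t)
    (hneg : ∀ t ∈ Set.Ioc t₀ t₁, ∀ (v : Fin p → ℝ) (μ : ℝ), μ < 0 → M t *ᵥ v = μ • v →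
      0 ≤ v ⬝ᵥ (M' t *ᵥ v))
    (h0 : (M t₀).PosSemidef) : ∀ t ∈ Set.Icc t₀ t₁, (M t).PosSemidef := by
  have hform : ∀ (ε t : ℝ) (v : Fin p → ℝ), v ⬝ᵥ ((M t + (ε * (1 + (t - t₀))) • 1) *ᵥ v) =
      v ⬝ᵥ (M t *ᵥ v) + ε * (1 + (t - t₀)) * (v ⬝ᵥ v) := fun ε t v => by
    rw [add_mulVec, dotProduct_add, smul_mulVec, dotProduct_smul, one_mulVec, smul_eq_mul]
  -- The perturbation `ε (1 + (t - t₀))` is positive at `t₀`, which gives a strict start, and has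
  -- slope `ε`, which turns the weak derivative inequality into a strict one.
  suffices key : ∀ ε : ℝ, 0 < ε → ∀ t ∈ Set.Icc t₀ t₁, ∀ v ∈ Metric.sphere (0 : Fin p → ℝ) 1,
      0 < v ⬝ᵥ ((M t + (ε * (1 + (t - t₀))) • 1) *ᵥ v) by
    intro t ht
    refine posSemidef_iff_isSymm.2 ⟨hs t, fun v => ?_⟩
    by_cases hv : v = 0
    · simp [hv]
    obtain ⟨w, hw, c, hc, rfl⟩ := exists_sphere_smul hv
    rw [quadForm_smul]
    refine mul_nonneg (sq_nonneg c) ?_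
    have hlim : Tendsto (fun ε : ℝ => w ⬝ᵥ (M t *ᵥ w) + ε * (1 + (t - t₀)) * (w ⬝ᵥ w))
        (𝓝[>] 0) (𝓝 (w ⬝ᵥ (M t *ᵥ w) + 0 * (1 + (t - t₀)) * (w ⬝ᵥ w))) :=
      Tendsto.mono_left (Continuous.tendsto (by fun_prop) 0) nhdsWithin_le_nhds
    rw [zero_mul, zero_mul, add_zero] at hlim
    refine ge_of_tendsto hlim ?_
    filter_upwards [self_mem_nhdsWithin] with ε hε
    rw [← hform]
    exact (key ε hε t ht w hw).le
  intro ε hε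
  by_contra! hcon
  obtain ⟨τ, hτ, u, hu, hτu⟩ := hcon
  set P : ℝ → Mat p := fun t => M t + (ε * (1 + (t - t₀))) • 1 with hP
  have hPs : ∀ t, (P t).IsSymm := fun t => (hs t).add (isSymm_one.smul _)
  have hPc : ContinuousOn P (Set.Icc t₀ t₁) :=
    hcont.add (Continuous.continuousOn (by fun_prop))
  have hq : ContinuousOn (fun z : ℝ × (Fin p → ℝ) => z.2 ⬝ᵥ (P z.1 *ᵥ z.2))
      (Set.Icc t₀ t₁ ×ˢ Metric.sphere 0 1) := by
    have h1 : ContinuousOn (fun z : ℝ × (Fin p → ℝ) => (P z.1, z.2))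
        (Set.Icc t₀ t₁ ×ˢ Metric.sphere 0 1) :=
      (hPc.comp continuousOn_fst fun z hz => hz.1).prodMk continuousOn_snd
    exact (continuous_quadForm continuous_fst continuous_snd).comp_continuousOn h1
  have hK : IsCompact ((Set.Icc t₀ t₁ ×ˢ Metric.sphere (0 : Fin p → ℝ) 1) ∩
      (fun z : ℝ × (Fin p → ℝ) => z.2 ⬝ᵥ (P z.1 *ᵥ z.2)) ⁻¹' Set.Iic 0) := by
    have hc : IsCompact (Set.Icc t₀ t₁ ×ˢ Metric.sphere (0 : Fin p → ℝ) 1) :=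
      isCompact_Icc.prod (isCompact_sphere _ _)
    exact hc.of_isClosed_subset (hq.preimage_isClosed_of_isClosed hc.isClosed isClosed_Iic)
      Set.inter_subset_left
  -- The first time `s` at which the perturbed form is nonpositive on some unit vector `v`.
  obtain ⟨⟨s, v⟩, ⟨⟨hs1, hv1⟩, hv2⟩, hmin⟩ :=
    hK.exists_isMinOn ⟨(τ, u), ⟨hτ, hu⟩, hτu⟩ continuous_fst.continuousOn
  have hbefore : ∀ t ∈ Set.Ico t₀ s, ∀ w ∈ Metric.sphere (0 : Fin p → ℝ) 1,
      0 < w ⬝ᵥ (P t *ᵥ w) := fun t ht w hw => by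
    by_contra! hle
    have : s ≤ t := hmin (a := (t, w)) ⟨⟨⟨ht.1, ht.2.le.trans hs1.2⟩, hw⟩, hle⟩
    exact absurd ht.2 this.not_gt
  have hv0 : v ≠ 0 := ne_zero_of_mem_unit_sphere hv1
  have hvv : 0 < v ⬝ᵥ v := by
    have := dotProduct_self_star_pos_iff.2 hv0
    simpa using this
  have hst : t₀ < s := by
    refine lt_of_le_of_ne hs1.1 ?_
    rintro rfl
    have h1 := (posSemidef_iff_isSymm.1 h0).2 v
    have h2 : v ⬝ᵥ (P t₀ *ᵥ v) ≤ 0 := hv2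
    rw [hform, sub_self, add_zero, mul_one] at h2
    nlinarith
  have hsIoc : s ∈ Set.Ioc t₀ t₁ := ⟨hst, hs1.2⟩
  have hev : ∀ᶠ t in 𝓝[<] s, t ∈ Set.Ico t₀ s := by
    filter_upwards [Ico_mem_nhdsLT hst] with t ht using ht
  have hPsd : (P s).PosSemidef := by
    refine posSemidef_iff_isSymm.2 ⟨hPs s, fun w => ?_⟩
    by_cases hw : w = 0
    · simp [hw]
    obtain ⟨w', hw', c, hc, rfl⟩ := exists_sphere_smul hw
    rw [quadForm_smul]
    refine mul_nonneg (sq_nonneg c) ?_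
    have hc1 : Tendsto (fun t => w' ⬝ᵥ (P t *ᵥ w')) (𝓝[<] s) (𝓝 (w' ⬝ᵥ (P s *ᵥ w'))) := by
      have h1 : ContinuousWithinAt P (Set.Ico t₀ s) s := (hPc s hs1).mono
        fun t ht => ⟨ht.1, ht.2.le.trans hs1.2⟩
      rw [ContinuousWithinAt, nhdsWithin_Ico_eq_nhdsLT hst] at h1
      exact ((continuous_quadForm continuous_id continuous_const).tendsto (P s)).comp h1
    exact ge_of_tendsto hc1 (hev.mono fun t ht => (hbefore t ht w' hw').le)
  have hzero : v ⬝ᵥ (P s *ᵥ v) = 0 :=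
    le_antisymm hv2 ((posSemidef_iff_isSymm.1 hPsd).2 v)
  -- By minimality of `s`, `P s` is positive semidefinite and has `v` in its kernel; thus `v` is an
  -- eigenvector of `M s` with negative eigenvalue, exactly where `hneg` applies.
  have heig : M s *ᵥ v = (-(ε * (1 + (s - t₀)))) • v := by
    have := mulVec_eq_zero_of_posSemidef hPsd hzero
    rw [hP, add_mulVec, smul_mulVec, one_mulVec] at this
    rw [neg_smul]
    exact eq_neg_of_add_eq_zero_left this
  have hnn := hneg s hsIoc v _ (neg_neg_of_pos (mul_pos hε (by linarith))) heig
  have hd : HasDerivWithinAt (fun t => v ⬝ᵥ (P t *ᵥ v)) (v ⬝ᵥ (M' s *ᵥ v) + ε * (v ⬝ᵥ v))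
      (Set.Iio s) s := by
    have h1 : HasDerivAt (fun t => ε * (1 + (t - t₀)) * (v ⬝ᵥ v)) (ε * (v ⬝ᵥ v)) s := by
      have := ((((hasDerivAt_id s).sub_const t₀).const_add 1).const_mul ε).mul_const (v ⬝ᵥ v)
      exact this.congr_deriv (by ring)
    have h2 := ((hderiv s hsIoc v).mono Set.Iio_subset_Iic_self).add h1.hasDerivWithinAt
    exact h2.congr (fun t _ => hform ε t v) (hform ε s v)
  have hslope := hasDerivWithinAt_iff_tendsto_slope' (by simp) |>.1 hd
  -- The form at `v` is positive before `s` and zero at `s`, so its left derivative is nonpositive,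
  -- whereas `hnn` makes it at least `ε (v ⬝ᵥ v) > 0`.
  have hle : v ⬝ᵥ (M' s *ᵥ v) + ε * (v ⬝ᵥ v) ≤ 0 := by
    refine le_of_tendsto hslope (hev.mono fun t ht => ?_)
    rw [slope_def_field, hzero, sub_zero]
    exact div_nonpos_of_nonneg_of_nonpos (hbefore t ht v hv1).le (by linarith [ht.2])
  nlinarith

end Definiteness

/-! ### The barrier condition and forward invariance -/

section BarrierFunctions

open Filter Topology Matrix

variable {n m p : ℕ}

theorem isClosed_safeInter {f : E n → E n} {H : E n → Mat p} {α : ℕ → ℝ → ℝ} {r : ℕ}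
    (hΨ : ∀ i, 1 ≤ i → i ≤ r → Continuous (Psi f H α i)) : IsClosed (safeInter f H α r) := by
  have : safeInter f H α r = ⋂ i, ⋂ (_ : 1 ≤ i), ⋂ (_ : i ≤ r), safeSet f H α i := by
    ext x
    simp [safeInter]
  rw [this]
  exact isClosed_iInter fun i => isClosed_iInter fun h1 => isClosed_iInter fun h2 =>
    isClosed_setOf_posSemidef.preimage (hΨ i h1 h2)

theorem isSymm_dotMat (f : E n → E n) (g : E n → Matrix (Fin n) (Fin m) ℝ) {A : E n → Mat p}
    (hA : ∀ x, (A x).IsSymm) (x : E n) (u : E m) : (dotMat f g A x u).IsSymm := by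
  refine (isSymm_lieDeriv f hA x).add ?_
  rw [Matrix.IsSymm, transpose_sum]
  exact Finset.sum_congr rfl fun j _ => by
    rw [transpose_smul, (isSymm_lieDeriv (col g j) hA x).eq]

/-- Positivity of the input term on the minimal eigenspace makes the derivative of `A` positive on
the kernel of `A x`, for a suitable input. -/
theorem exists_input_pos_on_kernel {f : E n → E n} {g : E n → Matrix (Fin n) (Fin m) ℝ}
    {A : E n → Mat p} (hA : ∀ x, (A x).IsSymm) {x : E n} {q : ℕ} {V : Matrix (Fin p) (Fin q) ℝ}
    (hV : IsMinEigenbasis (A x) V) (hmin : lambdaMin (A x) = 0) {u₀ : E m}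
    (hu₀ : (Vᵀ * (∑ j, u₀ j • lieDeriv (col g j) A x) * V).PosDef) :
    ∃ u : E m, ∀ v : Fin p → ℝ, v ≠ 0 → A x *ᵥ v = 0 →
      0 < v ⬝ᵥ (dotMat f g A x u *ᵥ v) := by
  set G := ∑ j, u₀ j • lieDeriv (col g j) A x with hG
  set L := lieDeriv f A x with hL
  have hLs : (Vᵀ * L * V).IsSymm := by
    rw [Matrix.IsSymm, transpose_mul, transpose_mul, transpose_transpose,
      (isSymm_lieDeriv f hA x).eq, Matrix.mul_assoc]
  -- Finsler's lemma with a positive definite matrix, where the kernel condition is vacuous: a large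
  -- multiple of `u₀` dominates the drift on the minimal eigenspace.
  obtain ⟨s, -, hs⟩ := exists_posDef_add_smul hu₀.posSemidef hLs fun c hc hc0 => by
    have := (posDef_iff_isSymm.1 hu₀).2 c hc
    rw [hc0, dotProduct_zero] at this
    exact absurd this (lt_irrefl _)
  refine ⟨s • u₀, fun v hv hAv => ?_⟩
  have hmem : v ∈ Set.range (fun c : Fin q → ℝ => V *ᵥ c) := by
    rw [hV.2]
    show A x *ᵥ v = lambdaMin (A x) • v
    rw [hAv, hmin, zero_smul]
  obtain ⟨c, rfl⟩ := hmem
  have hc : c ≠ 0 := by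
    rintro rfl
    exact hv (mulVec_zero V)
  have h1 := (posDef_iff_isSymm.1 hs).2 c hc
  have h2 : dotMat f g A x (s • u₀) = L + s • G := by
    rw [dotMat, hG, Finset.smul_sum]
    simp only [PiLp.smul_apply, smul_eq_mul, mul_smul, ← hL]
  have h3 : Vᵀ * L * V + s • (Vᵀ * G * V) = Vᵀ * (L + s • G) * V := by
    rw [Matrix.mul_add, Matrix.add_mul, Matrix.mul_smul, Matrix.smul_mul]
  rw [h3, ← mulVec_mulVec, ← mulVec_mulVec, dotProduct_mulVec, vecMul_transpose] at h1
  rw [h2]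
  exact h1

/-- Finsler's lemma absorbs all directions outside the kernel of `Ψ_r` into the term `w Ψ_r`. Where
`Ψ_r` is positive definite the kernel is trivial and `u = 0` suffices. -/
theorem ODCondition_id {f : E n → E n} {g : E n → Matrix (Fin n) (Fin m) ℝ} {H : E n → Mat p}
    (hsymm : ∀ x, (H x).IsSymm) {α : ℕ → ℝ → ℝ} {r : ℕ} (hr : 1 ≤ r)
    (hdeg : ∀ x ∈ criticalBoundary f H α r, ∃ (q : ℕ) (V : Matrix (Fin p) (Fin q) ℝ),
      IsMinEigenbasis (Psi f H α r x) V ∧ ∃ u : E m,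
        (Vᵀ * (∑ j, u j • lieDeriv (col g j) (Psi f H α r) x) * V).PosDef) :
    ODCondition f g H α r id := by
  intro x hx
  have hs := isSymm_Psi f hsymm α r
  have hpsd : (Psi f H α r x).PosSemidef := hx r hr le_rfl
  have hid : cfc (id : ℝ → ℝ) (Psi f H α r x) = Psi f H α r x := cfc_id ℝ _ hpsd.isHermitian
  obtain ⟨u, hu⟩ : ∃ u : E m, ∀ v : Fin p → ℝ, v ≠ 0 → Psi f H α r x *ᵥ v = 0 →
      0 < v ⬝ᵥ (dotMat f g (Psi f H α r) x u *ᵥ v) := by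
    by_cases hpd : (Psi f H α r x).PosDef
    · refine ⟨0, fun v hv hv0 => ?_⟩
      have := (posDef_iff_isSymm.1 hpd).2 v hv
      rw [hv0, dotProduct_zero] at this
      exact absurd this (lt_irrefl _)
    · obtain ⟨q, V, hV, u₀, hu₀⟩ := hdeg x ⟨hx, hpd⟩
      exact exists_input_pos_on_kernel hs hV (lambdaMin_eq_zero hpsd hpd) hu₀
  obtain ⟨w, hw, h⟩ := exists_posDef_add_smul hpsd (isSymm_dotMat f g hs x u) hu
  exact ⟨u, w, hw, by rwa [hid, sub_neg_eq_add]⟩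

theorem isExtClassK_id : IsExtClassK id := ⟨continuous_id, strictMono_id, rfl⟩

/-- A curve along which the derivative of the symmetric matrix-valued function `A` dominates
`-w a(A)` with `w ≥ 0` never leaves the set where `A` is positive semidefinite. -/
theorem posSemidef_along_curve {A : E n → Mat p} (hs : ∀ x, (A x).IsSymm) (hA : Continuous A)
    {x : ℝ → E n} {D : ℝ → Mat p} {t₀ t₁ : ℝ} (hx : ContinuousOn x (Set.Icc t₀ t₁))
    (hD : ∀ t ∈ Set.Ioc t₀ t₁, ∀ v : Fin p → ℝ,
      HasDerivAt (fun t => v ⬝ᵥ (A (x t) *ᵥ v)) (v ⬝ᵥ (D t *ᵥ v)) t) {a : ℝ → ℝ}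
    (ha : IsExtClassK a)
    (hle : ∀ t ∈ Set.Ioc t₀ t₁, ∃ w : ℝ, 0 ≤ w ∧ (D t + w • cfc a (A (x t))).PosSemidef)
    (h0 : (A (x t₀)).PosSemidef) : ∀ t ∈ Set.Icc t₀ t₁, (A (x t)).PosSemidef := by
  refine posSemidef_of_deriv_nonneg (M := fun t => A (x t)) (M' := D) (fun t => hs _)
    (hA.comp_continuousOn hx) (fun t ht v => ?_) (fun t ht v μ hμ hv => ?_) h0
  · exact (hD t ht v).hasDerivWithinAt
  · obtain ⟨w, hw, h⟩ := hle t ht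
    have h1 := (posSemidef_iff_isSymm.1 h).2 v
    rw [add_mulVec, dotProduct_add, smul_mulVec, dotProduct_smul,
      cfc_mulVec_of_eigenvector a (hs _) hv, dotProduct_smul, smul_eq_mul, smul_eq_mul] at h1
    have h2 : a μ ≤ 0 := by
      rw [← ha.map_zero]
      exact ha.strictMono.monotone hμ.le
    have h3 : 0 ≤ v ⬝ᵥ v := by
      have := dotProduct_self_star_nonneg v
      simpa using this
    have h4 : w * (a μ * (v ⬝ᵥ v)) ≤ 0 :=
      mul_nonpos_of_nonneg_of_nonpos hw (mul_nonpos_of_nonpos_of_nonneg h2 h3)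
    linarith

/-- The inequality is required on a neighborhood `W` of the safe set because the eigenvalue argument
tests it at states where `Ψ_r` would have a negative eigenvalue. Each time spent in the safe set is
followed by a short interval spent in `W`, and a continuation argument on `[0, b]` concludes. -/
theorem forwardInvariant_safeInter {f : E n → E n} {g : E n → Matrix (Fin n) (Fin m) ℝ}
    {H : E n → Mat p} (hsymm : ∀ x, (H x).IsSymm) {α : ℕ → ℝ → ℝ} {r : ℕ} (hr : 1 ≤ r)
    (hα : ∀ i, 1 ≤ i → i < r → IsExtClassK (α i))
    (hΨ : ∀ i, 1 ≤ i → i ≤ r → SmoothMat (Psi f H α i))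
    (hlevel : ∀ i, 1 ≤ i → i < r → ∀ (j : Fin m) (x : E n),
      lieDeriv (col g j) (Psi f H α i) x = 0)
    {W : Set (E n)} (hW : IsOpen W) (hCW : safeInter f H α r ⊆ W) {k : E n → E m} {a : ℝ → ℝ}
    (ha : IsExtClassK a)
    (hk : ∀ x ∈ W, ∃ w : ℝ, 0 ≤ w ∧
      (dotMat f g (Psi f H α r) x (k x) + w • cfc a (Psi f H α r x)).PosSemidef) :
    ForwardInvariant (closedLoop f g k) (safeInter f H α r) := by
  intro T x hx hx0 b hb
  have hΨc : ∀ i, 1 ≤ i → i ≤ r → Continuous (Psi f H α i) := fun i h1 h2 =>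
    continuous_matrix fun j l => (hΨ i h1 h2 j l).continuous
  have hxc : ContinuousOn x (Set.Ico 0 T) := fun t ht => (hx t ht).continuousWithinAt
  suffices Set.Icc 0 b ⊆ x ⁻¹' safeInter f H α r from this (Set.right_mem_Icc.2 hb.1)
  refine IsClosed.Icc_subset_of_forall_exists_gt ?_ hx0 ?_
  · rw [Set.inter_comm]
    exact (hxc.mono fun t ht => ⟨ht.1, ht.2.trans_lt hb.2⟩).preimage_isClosed_of_isClosed
      isClosed_Icc (isClosed_safeInter hΨc)
  rintro τ ⟨hτC, hτ⟩ y hy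
  have hτT : τ ∈ Set.Ico 0 T := ⟨hτ.1, hτ.2.trans hb.2⟩
  have hnear : x ⁻¹' W ∈ 𝓝[≥] τ := by
    have h1 := hxc τ hτT (hW.mem_nhds (hCW hτC))
    exact nhdsWithin_le_of_mem (mem_of_superset (Ico_mem_nhdsGE hτT.2)
      (Set.Ico_subset_Ico_left hτ.1)) h1
  obtain ⟨z, hz, hzW⟩ := (mem_nhdsGE_iff_exists_Icc_subset).1 hnear
  set t₁ := min z (min y b) with ht₁
  have hτt₁ : τ < t₁ := lt_min hz (lt_min hy hτ.2)
  have hsub : ∀ t ∈ Set.Icc τ t₁, t ∈ Set.Ico 0 T := fun t ht =>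
    ⟨hτ.1.trans ht.1, (ht.2.trans ((min_le_right _ _).trans (min_le_right _ _))).trans_lt hb.2⟩
  have hxW : ∀ t ∈ Set.Icc τ t₁, x t ∈ W := fun t ht =>
    hzW ⟨ht.1, ht.2.trans (min_le_left _ _)⟩
  have hderiv : ∀ i, 1 ≤ i → i ≤ r → ∀ t ∈ Set.Ioc τ t₁, ∀ v : Fin p → ℝ,
      HasDerivAt (fun t => v ⬝ᵥ (Psi f H α i (x t) *ᵥ v))
        (v ⬝ᵥ (dotMat f g (Psi f H α i) (x t) (k (x t)) *ᵥ v)) t := fun i h1 h2 t ht v => by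
    have htT := hsub t ⟨ht.1.le, ht.2⟩
    exact (hasDerivWithinAt_quadForm_closedLoop (hΨ i h1 h2) (hx t htT) v).hasDerivAt (Ico_mem_nhds (hτ.1.trans_lt ht.1) htT.2)
  -- Downward induction from level `r`: once `Ψ_{i+2} ⪰ 0` is known, `L_f Ψ_{i+1} + α_{i+1}(Ψ_{i+1})
  -- = Ψ_{i+2}` is the required inequality for `Ψ_{i+1}` with `w = 1`.
  have hlev : ∀ d, d < r → ∀ t ∈ Set.Icc τ t₁, (Psi f H α (r - d) (x t)).PosSemidef := by
    intro d
    induction d with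
    | zero =>
      intro _
      exact posSemidef_along_curve (D := fun t => dotMat f g (Psi f H α r) (x t) (k (x t)))
        (isSymm_Psi f hsymm α r) (hΨc r hr le_rfl)
        (hxc.mono hsub) (hderiv r hr le_rfl) ha
        (fun t ht => hk _ (hxW t ⟨ht.1.le, ht.2⟩)) (hτC r hr le_rfl)
    | succ d ih =>
      intro hd
      obtain ⟨i, hi⟩ : ∃ i, r - (d + 1) = i + 1 := ⟨r - d - 2, by omega⟩
      have hi' : r - d = i + 2 := by omega
      rw [hi]
      refine posSemidef_along_curve
        (D := fun t => dotMat f g (Psi f H α (i + 1)) (x t) (k (x t)))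
        (isSymm_Psi f hsymm α _) (hΨc _ (by omega) (by omega))
        (hxc.mono hsub) (hderiv _ (by omega) (by omega)) (hα (i + 1) (by omega) (by omega))
        (fun t ht => ⟨1, zero_le_one, ?_⟩) (hτC _ (by omega) (by omega))
      have h1 := ih (by omega) t ⟨ht.1.le, ht.2⟩
      rw [hi'] at h1
      have h2 : dotMat f g (Psi f H α (i + 1)) (x t) (k (x t)) =
          lieDeriv f (Psi f H α (i + 1)) (x t) := by
        rw [dotMat, Finset.sum_eq_zero, add_zero]
        intro j _
        rw [hlevel (i + 1) (by omega) (by omega), smul_zero]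
      rw [h2, one_smul]
      exact h1
  refine ⟨t₁, fun i h1 h2 => ?_, hτt₁, (min_le_right _ _).trans (min_le_left _ _)⟩
  have := hlev (r - i) (by omega) t₁ ⟨hτt₁.le, le_rfl⟩
  rwa [Nat.sub_sub_self h2] at this

end BarrierFunctions

/-! ### Continuity of minimizers in a parameter -/

section ParametricMinimization

open Filter Topology

/-- Continuity of a unique, locally bounded minimizer, when the feasible sets have closed graph and
nearly optimal feasible points persist under perturbation of the parameter. -/
theorem continuousAt_minimizer {X Z : Type*} [TopologicalSpace X] [TopologicalSpace Z]
    {J : X → Z → ℝ} {K : X → Set Z} {sol : X → Z} {x₀ : X}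
    (hJ : Continuous (Function.uncurry J)) (hmem : ∀ᶠ x in 𝓝 x₀, sol x ∈ K x)
    (hmin : ∀ᶠ x in 𝓝 x₀, IsMinOn (J x) (K x) (sol x))
    (hK : IsClosed {q : X × Z | q.2 ∈ K q.1})
    (hpersist : ∀ η, J x₀ (sol x₀) < η → ∃ z, J x₀ z < η ∧ ∀ᶠ x in 𝓝 x₀, z ∈ K x)
    (hbdd : ∃ C : Set Z, IsCompact C ∧ ∀ᶠ x in 𝓝 x₀, sol x ∈ C)
    (huniq : ∀ z ∈ K x₀, J x₀ z ≤ J x₀ (sol x₀) → z = sol x₀) : ContinuousAt sol x₀ := by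
  rw [ContinuousAt, tendsto_iff_ultrafilter]
  intro F hF
  obtain ⟨C, hC, hCmem⟩ := hbdd
  obtain ⟨z, -, hz⟩ := hC.ultrafilter_le_nhds (F.map sol)
    (by rw [Ultrafilter.coe_map, le_principal_iff]; exact hF hCmem)
  have hz' : Tendsto sol F (𝓝 z) := hz
  have hpair : Tendsto (fun x => (x, sol x)) F (𝓝 (x₀, z)) := Tendsto.prodMk_nhds hF hz'
  have hzK : z ∈ K x₀ := hK.mem_of_tendsto hpair (hF hmem)
  -- Any ultrafilter limit `z` of minimizers is compared with nearly optimal points that stay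
  -- feasible nearby; uniqueness then identifies `z`.
  have hle : J x₀ z ≤ J x₀ (sol x₀) := by
    refine le_of_forall_gt_imp_ge_of_dense fun η hη => ?_
    obtain ⟨y, hy, hyK⟩ := hpersist η hη
    have h1 : Tendsto (fun x => J x (sol x)) F (𝓝 (J x₀ z)) := (hJ.tendsto (x₀, z)).comp hpair
    have h2 : Tendsto (fun x => J x y) F (𝓝 (J x₀ y)) :=
      (hJ.tendsto (x₀, y)).comp (Tendsto.prodMk_nhds hF tendsto_const_nhds)
    have h3 : ∀ᶠ x in (F : Filter X), J x (sol x) ≤ J x y := by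
      filter_upwards [hF hmin, hF hyK] with x hx hxy using hx hxy
    exact (le_of_tendsto_of_tendsto h1 h2 h3).trans hy.le
  rw [← huniq z hzK hle]
  exact hz'

end ParametricMinimization

/-! ### The semidefinite program with strictly feasible points -/

section SafetyFilter

open Filter Topology Matrix

variable {m p : ℕ}

/-- The affine matrix pencil `B₀ + ∑ⱼ uⱼ Bⱼ + w N` evaluated at the state `x` and at
`z = (u, w)`. -/
def pencil {X : Type*} (B₀ : X → Mat p) (B : Fin m → X → Mat p) (N : X → Mat p) (x : X)
    (z : E m × ℝ) : Mat p :=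
  B₀ x + ∑ j, z.1 j • B j x + z.2 • N x

/-- The pairs `z = (u, w)` with `w ≥ 0`, `w ≥ θ` at which the pencil is positive semidefinite. -/
def pencilFeasible {X : Type*} (B₀ : X → Mat p) (B : Fin m → X → Mat p) (N : X → Mat p) (θ : ℝ)
    (x : X) : Set (E m × ℝ) :=
  {z | 0 ≤ z.2 ∧ θ ≤ z.2 ∧ (pencil B₀ B N x z).PosSemidef}

/-- The states at which some pair `(u, w)` with `w ≥ 0`, `w ≥ θ` makes the pencil positive
definite. -/
def pencilStrict {X : Type*} (B₀ : X → Mat p) (B : Fin m → X → Mat p) (N : X → Mat p) (θ : ℝ) :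
    Set X :=
  {x | ∃ z : E m × ℝ, 0 ≤ z.2 ∧ θ ≤ z.2 ∧ (pencil B₀ B N x z).PosDef}

variable {X : Type*} {B₀ : X → Mat p} {B : Fin m → X → Mat p} {N : X → Mat p} {θ : ℝ}

theorem pencil_convexComb {s t : ℝ} (hst : s + t = 1) (x : X) (y z : E m × ℝ) :
    pencil B₀ B N x (s • y + t • z) = s • pencil B₀ B N x y + t • pencil B₀ B N x z := by
  have h : B₀ x = s • B₀ x + t • B₀ x := by rw [← add_smul, hst, one_smul]
  simp only [pencil, Prod.fst_add, Prod.smul_fst, Prod.snd_add, Prod.smul_snd, PiLp.add_apply,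
    PiLp.smul_apply, smul_eq_mul, add_smul, mul_smul, Finset.sum_add_distrib, smul_add,
    Finset.smul_sum]
  conv_lhs => rw [h]
  abel

theorem convex_pencilFeasible (x : X) : Convex ℝ (pencilFeasible B₀ B N θ x) := by
  rintro y ⟨hy0, hyθ, hy⟩ z ⟨hz0, hzθ, hz⟩ s t hs ht hst
  refine ⟨?_, ?_, ?_⟩
  · simp only [Prod.snd_add, Prod.smul_snd, smul_eq_mul]
    positivity
  · simp only [Prod.snd_add, Prod.smul_snd, smul_eq_mul]
    calc θ = s * θ + t * θ := by rw [← add_mul, hst, one_mul]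
      _ ≤ _ := by gcongr
  · rw [pencil_convexComb hst]
    exact (hy.smul hs).add (hz.smul ht)

theorem continuous_pencil [TopologicalSpace X] (hB₀ : Continuous B₀) (hB : ∀ j, Continuous (B j))
    (hN : Continuous N) : Continuous (fun q : X × (E m × ℝ) => pencil B₀ B N q.1 q.2) := by
  refine ((hB₀.comp continuous_fst).add (continuous_finsetSum _ fun j _ => ?_)).add ?_
  · have h : Continuous (fun q : X × (E m × ℝ) => q.2.1 j) := by fun_prop
    exact h.smul ((hB j).comp continuous_fst)
  · exact (continuous_snd.comp continuous_snd).smul (hN.comp continuous_fst)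

theorem isSymm_pencil (hB₀ : ∀ x, (B₀ x).IsSymm) (hB : ∀ j x, (B j x).IsSymm)
    (hN : ∀ x, (N x).IsSymm) (x : X) (z : E m × ℝ) : (pencil B₀ B N x z).IsSymm := by
  refine ((hB₀ x).add ?_).add ((hN x).smul _)
  rw [Matrix.IsSymm, transpose_sum]
  exact Finset.sum_congr rfl fun j _ => by rw [transpose_smul, (hB j x).eq]

theorem isClosed_graph_pencilFeasible [TopologicalSpace X]
    (h : Continuous (fun q : X × (E m × ℝ) => pencil B₀ B N q.1 q.2)) :
    IsClosed {q : X × (E m × ℝ) | q.2 ∈ pencilFeasible B₀ B N θ q.1} := by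
  refine (isClosed_le continuous_const (continuous_snd.comp continuous_snd)).inter
    ((isClosed_le continuous_const (continuous_snd.comp continuous_snd)).inter ?_)
  exact isClosed_setOf_posSemidef.preimage h

theorem eventually_posDef_pencil [TopologicalSpace X]
    (h : Continuous (fun q : X × (E m × ℝ) => pencil B₀ B N q.1 q.2))
    (hs : ∀ x z, (pencil B₀ B N x z).IsSymm) {x₀ : X} {z : E m × ℝ}
    (hz : (pencil B₀ B N x₀ z).PosDef) : ∀ᶠ x in 𝓝 x₀, (pencil B₀ B N x z).PosDef :=
  (isOpen_setOf_posDef (A := fun x => pencil B₀ B N x z)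
    (h.comp (Continuous.prodMk_left z)) fun x => hs x z).mem_nhds hz

theorem isOpen_pencilStrict [TopologicalSpace X]
    (h : Continuous (fun q : X × (E m × ℝ) => pencil B₀ B N q.1 q.2))
    (hs : ∀ x z, (pencil B₀ B N x z).IsSymm) : IsOpen (pencilStrict B₀ B N θ) := by
  rw [isOpen_iff_mem_nhds]
  rintro x₀ ⟨z, hz0, hzθ, hz⟩
  filter_upwards [eventually_posDef_pencil h hs hz] with x hx using ⟨z, hz0, hzθ, hx⟩

variable {n : ℕ} {knom : E n → E m} {c : ℝ}

theorem continuous_sdpCost (hk : Continuous knom) (c θ : ℝ) {Y : Type*} [TopologicalSpace Y]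
    {a : Y → E n} {b : Y → E m × ℝ} (ha : Continuous a) (hb : Continuous b) :
    Continuous (fun y => sdpCost knom c θ (a y) (b y)) := by
  unfold sdpCost
  fun_prop

theorem mem_closedBall_of_sdpCost_le (hc : 0 < c) {x : E n} {R b : ℝ} (hR : ‖knom x‖ ≤ R)
    {z : E m × ℝ} (hz : sdpCost knom c θ x z ≤ b) :
    z ∈ Metric.closedBall (0 : E m × ℝ) (1 + b + R + (1 + b / c + |θ|)) := by
  rw [sdpCost] at hz
  have hcw : 0 ≤ c * (z.2 - θ) ^ 2 := by positivity
  have hu2 : ‖z.1 - knom x‖ ^ 2 ≤ b := by linarith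
  have hb : 0 ≤ b := (sq_nonneg _).trans hu2
  have hw2 : |z.2 - θ| ^ 2 ≤ b / c := by
    rw [sq_abs, le_div_iff₀ hc]
    nlinarith [sq_nonneg ‖z.1 - knom x‖]
  -- A bound linear in `d` replaces the square root; the radius adds the bounds for both components,
  -- which dominates their maximum.
  have hsq : ∀ s d : ℝ, s ^ 2 ≤ d → s ≤ 1 + d := fun s d h => by nlinarith [sq_nonneg (s - 1)]
  have hu : ‖z.1‖ ≤ 1 + b + R := by
    calc ‖z.1‖ = ‖(z.1 - knom x) + knom x‖ := by rw [sub_add_cancel]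
      _ ≤ ‖z.1 - knom x‖ + ‖knom x‖ := norm_add_le _ _
      _ ≤ 1 + b + R := add_le_add (hsq _ _ hu2) hR
  have hw : ‖z.2‖ ≤ 1 + b / c + |θ| := by
    calc ‖z.2‖ = |(z.2 - θ) + θ| := by rw [sub_add_cancel, Real.norm_eq_abs]
      _ ≤ |z.2 - θ| + |θ| := abs_add_le _ _
      _ ≤ _ := add_le_add (hsq _ _ hw2) le_rfl
  have hu0 := norm_nonneg z.1
  have hw0 := norm_nonneg z.2
  rw [mem_closedBall_zero_iff, Prod.norm_def]
  exact max_le (by linarith) (by linarith)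

theorem exists_isMinOn_sdpCost (hk : Continuous knom) (hc : 0 < c) (x : E n)
    {K : Set (E m × ℝ)} (hK : IsClosed K) (hne : K.Nonempty) :
    ∃ z ∈ K, IsMinOn (sdpCost knom c θ x) K z := by
  obtain ⟨y, hy⟩ := hne
  have hcont : Continuous (fun z => sdpCost knom c θ x z) :=
    continuous_sdpCost hk c θ continuous_const continuous_id
  have hcomp : IsCompact (K ∩ {z | sdpCost knom c θ x z ≤ sdpCost knom c θ x y}) :=
    (isCompact_closedBall (0 : E m × ℝ)
      (1 + sdpCost knom c θ x y + ‖knom x‖ +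
        (1 + sdpCost knom c θ x y / c + |θ|))).of_isClosed_subset (hK.inter (isClosed_le hcont continuous_const)) fun z hz => by
        have hz2 : sdpCost knom c θ x z ≤ sdpCost knom c θ x y := hz.2
        exact mem_closedBall_of_sdpCost_le hc le_rfl hz2
  obtain ⟨z, hz, hmin⟩ := hcomp.exists_isMinOn ⟨y, hy, Set.mem_ofPred_eq ▸ le_refl (sdpCost knom c θ x y)⟩ hcont.continuousOn
  refine ⟨z, hz.1, fun z' hz' => ?_⟩
  by_cases h : sdpCost knom c θ x z' ≤ sdpCost knom c θ x y
  · exact hmin ⟨hz', h⟩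
  · exact hz.2.trans (not_le.1 h).le

/-- The parallelogram law gives strong convexity with an explicit gap, so two distinct minimizers
would have a better midpoint. -/
theorem sdpCost_midpoint (x : E n) (y z : E m × ℝ) :
    sdpCost knom c θ x ((1 / 2 : ℝ) • y + (1 / 2 : ℝ) • z) =
      (sdpCost knom c θ x y + sdpCost knom c θ x z) / 2 -
        (‖y.1 - z.1‖ ^ 2 + c * (y.2 - z.2) ^ 2) / 4 := by
  have h := parallelogram_law_with_norm ℝ (y.1 - knom x) (z.1 - knom x)
  rw [sub_sub_sub_cancel_right] at h
  have h1 : (1 / 2 : ℝ) • y.1 + (1 / 2 : ℝ) • z.1 - knom x =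
      (1 / 2 : ℝ) • ((y.1 - knom x) + (z.1 - knom x)) := by
    have : knom x = (1 / 2 : ℝ) • knom x + (1 / 2 : ℝ) • knom x := by
      rw [← add_smul]; norm_num
    conv_lhs => rw [this]
    simp only [smul_add, smul_sub]
    abel
  simp only [sdpCost, Prod.fst_add, Prod.smul_fst, Prod.snd_add, Prod.smul_snd, smul_eq_mul]
  rw [h1, norm_smul, mul_pow, Real.norm_of_nonneg (by norm_num)]
  linear_combination (1 / 4 : ℝ) * h

theorem eq_of_isMinOn_sdpCost (hc : 0 < c) {x : E n} {K : Set (E m × ℝ)} (hK : Convex ℝ K)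
    {y z : E m × ℝ} (hy : y ∈ K) (hz : z ∈ K) (hmin : IsMinOn (sdpCost knom c θ x) K z)
    (hle : sdpCost knom c θ x y ≤ sdpCost knom c θ x z) : y = z := by
  have hmid := hmin (hK hy hz (a := 1 / 2) (b := 1 / 2) (by norm_num) (by norm_num) (by norm_num))
  have hmid' : sdpCost knom c θ x z ≤ sdpCost knom c θ x ((1 / 2 : ℝ) • y + (1 / 2 : ℝ) • z) :=
    hmid
  rw [sdpCost_midpoint] at hmid'
  have h1 : 0 ≤ c * (y.2 - z.2) ^ 2 := by positivity
  have h2 : 0 ≤ ‖y.1 - z.1‖ ^ 2 := by positivity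
  have h3 : ‖y.1 - z.1‖ ^ 2 = 0 := by linarith
  have h4 : c * (y.2 - z.2) ^ 2 = 0 := by linarith
  refine Prod.ext ?_ ?_
  · exact sub_eq_zero.1 (norm_eq_zero.1 (pow_eq_zero_iff two_ne_zero |>.1 h3))
  · exact sub_eq_zero.1 (pow_eq_zero_iff two_ne_zero |>.1
      ((mul_eq_zero.1 h4).resolve_left hc.ne'))

/-- On the open set of strictly feasible states the filter has a unique minimizer, which depends
continuously on the state. -/
theorem exists_continuousOn_minimizer {B₀ : E n → Mat p} {B : Fin m → E n → Mat p}
    {N : E n → Mat p}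
    (h : Continuous (fun q : E n × (E m × ℝ) => pencil B₀ B N q.1 q.2))
    (hs : ∀ x z, (pencil B₀ B N x z).IsSymm) (hk : Continuous knom) (hc : 0 < c) (θ : ℝ) :
    ∃ sol : E n → E m × ℝ, ContinuousOn sol (pencilStrict B₀ B N θ) ∧
      ∀ x ∈ pencilStrict B₀ B N θ, sol x ∈ pencilFeasible B₀ B N θ x ∧
        IsMinOn (sdpCost knom c θ x) (pencilFeasible B₀ B N θ x) (sol x) := by
  have hclosed := isClosed_graph_pencilFeasible (θ := θ) h
  have hex : ∀ x, ∃ z, x ∈ pencilStrict B₀ B N θ → z ∈ pencilFeasible B₀ B N θ x ∧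
      IsMinOn (sdpCost knom c θ x) (pencilFeasible B₀ B N θ x) z := fun x => by
    by_cases hx : x ∈ pencilStrict B₀ B N θ
    · obtain ⟨z, hz0, hzθ, hz⟩ := hx
      obtain ⟨y, hy, hy'⟩ := exists_isMinOn_sdpCost (θ := θ) hk hc x
        (hclosed.preimage (Continuous.prodMk_right x)) ⟨z, hz0, hzθ, hz.posSemidef⟩
      exact ⟨y, fun _ => ⟨hy, hy'⟩⟩
    · exact ⟨0, fun h => absurd h hx⟩
  choose sol hsol using hex
  refine ⟨sol, fun x₀ hx₀ => ContinuousAt.continuousWithinAt ?_, hsol⟩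
  have hnear : ∀ᶠ x in 𝓝 x₀, x ∈ pencilStrict B₀ B N θ :=
    (isOpen_pencilStrict h hs).mem_nhds hx₀
  have hcost : Continuous (fun q : E n × (E m × ℝ) => sdpCost knom c θ q.1 q.2) :=
    continuous_sdpCost hk c θ continuous_fst continuous_snd
  have hpersist : ∀ η, sdpCost knom c θ x₀ (sol x₀) < η → ∃ z, sdpCost knom c θ x₀ z < η ∧
      ∀ᶠ x in 𝓝 x₀, z ∈ pencilFeasible B₀ B N θ x := by
    intro η hη
    obtain ⟨y, hy0, hyθ, hy⟩ := hx₀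
    have hfeas : ∀ᶠ ε : ℝ in 𝓝[>] 0, ε ∈ Set.Ioo (0 : ℝ) 1 := Ioo_mem_nhdsGT one_pos
    have hlim : Tendsto (fun ε : ℝ => sdpCost knom c θ x₀ ((1 - ε) • sol x₀ + ε • y)) (𝓝[>] 0)
        (𝓝 (sdpCost knom c θ x₀ (sol x₀))) := by
      have h1 : Continuous (fun ε : ℝ => sdpCost knom c θ x₀ ((1 - ε) • sol x₀ + ε • y)) :=
        continuous_sdpCost hk c θ continuous_const (by fun_prop)
      have h2 := h1.tendsto 0
      simp only [sub_zero, one_smul, zero_smul, add_zero] at h2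
      exact h2.mono_left nhdsWithin_le_nhds
    obtain ⟨ε, hε, hε'⟩ := (hfeas.and (hlim.eventually (gt_mem_nhds hη))).exists
    have hsol₀ := (hsol x₀ ⟨y, hy0, hyθ, hy⟩).1
    have hcomb := convex_pencilFeasible x₀ hsol₀ ⟨hy0, hyθ, hy.posSemidef⟩
      (sub_nonneg.2 hε.2.le) hε.1.le (sub_add_cancel 1 ε)
    refine ⟨_, hε', ?_⟩
    -- Mixing a small part of the strictly feasible `y` into the minimizer makes the pencil positive
    -- definite, hence feasible for nearby states, at a cost still below `η`.
    have hpd : (pencil B₀ B N x₀ ((1 - ε) • sol x₀ + ε • y)).PosDef := by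
      rw [pencil_convexComb (sub_add_cancel 1 ε)]
      exact PosDef.posSemidef_add (hsol₀.2.2.smul (sub_nonneg.2 hε.2.le)) (hy.smul hε.1)
    filter_upwards [eventually_posDef_pencil h hs hpd] with x hx
    exact ⟨hcomb.1, hcomb.2.1, hx.posSemidef⟩
  refine continuousAt_minimizer (J := sdpCost knom c θ) (K := pencilFeasible B₀ B N θ) hcost
    (hnear.mono fun x hx => (hsol x hx).1)
    (hnear.mono fun x hx => (hsol x hx).2) hclosed hpersist ?_
    fun z hz hle => eq_of_isMinOn_sdpCost hc (convex_pencilFeasible x₀) hz (hsol x₀ hx₀).1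
      (hsol x₀ hx₀).2 hle
  -- One point feasible at all nearby states bounds the optimal cost there, hence also the
  -- minimizers.
  obtain ⟨z, hz, hzK⟩ := hpersist _ (lt_add_one _)
  refine ⟨_, isCompact_closedBall (0 : E m × ℝ)
    (1 + (sdpCost knom c θ x₀ (sol x₀) + 1) + (‖knom x₀‖ + 1) +
      (1 + (sdpCost knom c θ x₀ (sol x₀) + 1) / c + |θ|)), ?_⟩
  have h1 : ∀ᶠ x in 𝓝 x₀, ‖knom x‖ < ‖knom x₀‖ + 1 :=
    hk.norm.continuousAt.eventually (gt_mem_nhds (lt_add_one _))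
  have h2 : ∀ᶠ x in 𝓝 x₀, sdpCost knom c θ x z < sdpCost knom c θ x₀ (sol x₀) + 1 :=
    (continuous_sdpCost hk c θ continuous_id continuous_const).continuousAt.eventually
      (gt_mem_nhds hz)
  filter_upwards [hnear, hzK, h1, h2] with x hx hxz hx1 hx2
  exact mem_closedBall_of_sdpCost_le hc hx1.le (((hsol x hx).2 hxz).trans hx2.le)

end SafetyFilter

/-! ### Assembly of the safety filter -/

section Main

open Filter Topology Matrix

variable {n m p : ℕ}

theorem continuous_lieDeriv {v : E n → E n} {A : E n → Mat p} (hv : Continuous v)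
    (hA : SmoothMat A) : Continuous (lieDeriv v A) :=
  continuous_matrix fun i j => ((hA i j).continuous_fderiv (by simp)).clm_apply hv

/-- Continuity on an open set does not suffice for a global extension; shrinking to `W` with closure
inside `W₀` lets Tietze's theorem act on the closed set `closure W`. -/
theorem exists_continuous_extension {Y : Type} [TopologicalSpace Y] [TietzeExtension.{0} Y]
    {C W₀ : Set (E n)} (hC : IsClosed C) (hW₀ : IsOpen W₀) (hCW : C ⊆ W₀) {k₀ : E n → Y}
    (hk₀ : ContinuousOn k₀ W₀) :
    ∃ (W : Set (E n)) (k : E n → Y), IsOpen W ∧ C ⊆ W ∧ W ⊆ W₀ ∧ Continuous k ∧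
      ∀ x ∈ W, k x = k₀ x := by
  obtain ⟨W, hW, hCW', hWW₀⟩ := normal_exists_closure_subset hC hW₀ hCW
  obtain ⟨k, hk⟩ := ContinuousMap.exists_restrict_eq (isClosed_closure (s := W))
    ⟨(closure W).domRestrict k₀, (hk₀.mono hWW₀).domRestrict⟩
  exact ⟨W, k, hW, hCW', subset_closure.trans hWW₀, k.continuous, fun x hx =>
    DFunLike.congr_fun hk ⟨x, subset_closure hx⟩⟩

theorem sdpFeasible_eq (f : E n → E n) (g : E n → Matrix (Fin n) (Fin m) ℝ) (H : E n → Mat p)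
    (α : ℕ → ℝ → ℝ) (r : ℕ) (a : ℝ → ℝ) (θ : ℝ) (x : E n) :
    sdpFeasible f g H α r a θ x = pencilFeasible (lieDeriv f (Psi f H α r))
      (fun j => lieDeriv (col g j) (Psi f H α r)) (fun x => cfc a (Psi f H α r x)) θ x := by
  ext z
  rw [sdpFeasible, Set.mem_ofPred_eq, sub_neg_eq_add]
  rfl

theorem exists_safety_filter {f : E n → E n} (hf : ContDiff ℝ ∞ f)
    {g : E n → Matrix (Fin n) (Fin m) ℝ} (hg : SmoothMat g)
    {H : E n → Mat p} (hH : SmoothMat H) (hsymm : ∀ x, (H x).IsSymm) {α : ℕ → ℝ → ℝ} {r : ℕ}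
    (hr : 1 ≤ r) (hα : ∀ i, 1 ≤ i → i < r → IsExtClassK (α i) ∧ ContDiff ℝ ∞ (α i))
    (hlevel : ∀ i, 1 ≤ i → i < r → ∀ (j : Fin m) (x : E n),
      lieDeriv (col g j) (Psi f H α i) x = 0)
    {a : ℝ → ℝ} (ha : IsExtClassK a) (hod : ODCondition f g H α r a) {knom : E n → E m}
    {c : ℝ} (θ : ℝ) (hk : Continuous knom) (hc : 0 < c) :
    ∃ (W : Set (E n)) (k : E n → E m), IsOpen W ∧ safeInter f H α r ⊆ W ∧ Continuous k ∧
      (∀ x ∈ W, ∃ w : ℝ, IsSDPSolution f g H α r a knom c θ x (k x, w) ∧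
        ∀ z, IsSDPSolution f g H α r a knom c θ x z → z = (k x, w)) ∧
      ForwardInvariant (closedLoop f g k) (safeInter f H α r) := by
  have hΨ : ∀ i, 1 ≤ i → i ≤ r → SmoothMat (Psi f H α i) := fun i h1 h2 => by
    obtain ⟨i, rfl⟩ : ∃ l, i = l + 1 := ⟨i - 1, by omega⟩
    exact smoothMat_iff.2 (contDiff_Psi hf hH hsymm (fun i h1 h2 => (hα i h1 h2).2) i h2)
  have hΨc : ∀ i, 1 ≤ i → i ≤ r → Continuous (Psi f H α i) := fun i h1 h2 =>
    continuous_matrix fun j l => (hΨ i h1 h2 j l).continuous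
  have hΨs := isSymm_Psi f hsymm α r
  set N : E n → Mat p := fun x => cfc a (Psi f H α r x) with hN
  have hNc : Continuous N := by
    have h := (continuous_spectralMap ha.continuous).comp (hΨc r hr le_rfl)
    refine h.congr fun x => ?_
    rw [Function.comp_apply, spectralMap, symPart_of_isSymm (hΨs x)]
  have hpc := continuous_pencil (continuous_lieDeriv hf.continuous (hΨ r hr le_rfl))
    (fun j : Fin m => continuous_lieDeriv (contDiff_col hg j).continuous (hΨ r hr le_rfl)) hNc
  have hps := isSymm_pencil (isSymm_lieDeriv f hΨs)
    (fun j : Fin m => isSymm_lieDeriv (col g j) hΨs) fun x => isSymm_cfc a (Psi f H α r x)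
  obtain ⟨sol, hsolc, hsol⟩ := exists_continuousOn_minimizer hpc hps hk hc θ
  have hsub : safeInter f H α r ⊆ pencilStrict (lieDeriv f (Psi f H α r))
      (fun j => lieDeriv (col g j) (Psi f H α r)) N θ := by
    intro x hx
    obtain ⟨u, w, hw, h⟩ := hod x hx
    rw [sub_neg_eq_add] at h
    -- The barrier condition ignores the bound `w ≥ θ`. Raising `w` is harmless on the safe set,
    -- where `a(Ψ_r)` is positive semidefinite.
    refine ⟨(u, max w θ), hw.trans (le_max_left _ _), le_max_right _ _, ?_⟩
    have hpsd : (N x).PosSemidef := by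
      obtain ⟨U, d, hU, hU', hd, hcfc⟩ := exists_orthogonal_diagonalization (hΨs x)
      refine posSemidef_iff_isSymm.2 ⟨isSymm_cfc _ _, fun v => ?_⟩
      have hdnn : ∀ i, 0 ≤ d i := fun i => by
        have h1 := (posSemidef_iff_isSymm.1 (hx r hr le_rfl)).2 (U *ᵥ Pi.single i 1)
        have h2 : Psi f H α r x *ᵥ (U *ᵥ Pi.single i 1) = U *ᵥ (diagonal d *ᵥ Pi.single i 1) := by
          conv_lhs => rw [hd]
          rw [mulVec_mulVec, Matrix.mul_assoc, hU, Matrix.mul_one, mulVec_mulVec]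
        rw [h2, dotProduct_mulVec, ← mulVec_transpose, mulVec_mulVec, hU, one_mulVec] at h1
        simpa using h1
      have hann : ∀ i, 0 ≤ a (d i) := fun i => by
        rw [← ha.map_zero]
        exact ha.strictMono.monotone (hdnn i)
      have h3 : v ⬝ᵥ (N x *ᵥ v) = ∑ i, a (d i) * (Uᵀ *ᵥ v) i ^ 2 := by
        rw [hN]
        simp only [hcfc]
        rw [← mulVec_mulVec, ← mulVec_mulVec, dotProduct_mulVec, ← mulVec_transpose, dotProduct]
        refine Finset.sum_congr rfl fun i _ => ?_
        rw [mulVec_diagonal, Function.comp_apply]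
        ring
      rw [h3]
      exact Finset.sum_nonneg fun i _ => mul_nonneg (hann i) (sq_nonneg _)
    have h1 : pencil (lieDeriv f (Psi f H α r)) (fun j => lieDeriv (col g j) (Psi f H α r)) N x
        (u, max w θ) = (dotMat f g (Psi f H α r) x u + w • N x) + (max w θ - w) • N x := by
      rw [add_assoc, ← add_smul, add_sub_cancel]
      rfl
    rw [h1]
    exact h.add_posSemidef (hpsd.smul (sub_nonneg.2 (le_max_left _ _)))
  obtain ⟨W, k, hW, hCW, hWW₀, hkc, hkW⟩ := exists_continuous_extension
    (isClosed_safeInter hΨc) (isOpen_pencilStrict hpc hps) hsub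
    (continuous_fst.comp_continuousOn hsolc)
  have hkW' : ∀ x ∈ W, sol x = (k x, (sol x).2) := fun x hx => Prod.ext (hkW x hx).symm rfl
  refine ⟨W, k, hW, hCW, hkc, fun x hx => ⟨(sol x).2, ?_, fun z hz => ?_⟩, ?_⟩
  · rw [← hkW' x hx, IsSDPSolution, sdpFeasible_eq]
    exact hsol x (hWW₀ hx)
  · rw [IsSDPSolution, sdpFeasible_eq] at hz
    rw [← hkW' x hx]
    have hs := hsol x (hWW₀ hx)
    exact eq_of_isMinOn_sdpCost hc (convex_pencilFeasible x) hz.1 hs.1 hs.2 (hz.2 hs.1)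
  · refine forwardInvariant_safeInter hsymm hr (fun i h1 h2 => (hα i h1 h2).1) hΨ hlevel hW hCW ha
      fun x hx => ⟨(sol x).2, (hsol x (hWW₀ hx)).1.1, ?_⟩
    have h := (hsol x (hWW₀ hx)).1.2.2
    rw [hkW' x hx] at h
    exact h

end Main

end MatrixCBF

theorem mainTheorem1 (n m p r : ℕ) (hr : 1 ≤ r)
    -- the smooth control-affine system `ẋ = f(x) + g(x) u`
    (f : MatrixCBF.E n → MatrixCBF.E n) (hf : ContDiff ℝ ∞ f)
    (g : MatrixCBF.E n → Matrix (Fin n) (Fin m) ℝ) (hg : MatrixCBF.SmoothMat g)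
    -- the smooth symmetric matrix-valued function `H`
    (H : MatrixCBF.E n → MatrixCBF.Mat p) (hH : MatrixCBF.SmoothMat H)
    (hsymm : ∀ x, (H x).IsSymm)
    -- smooth extended class-K functions `α₁, …, α_{r-1}`
    (α : ℕ → ℝ → ℝ)
    (hα : ∀ i, 1 ≤ i → i < r → MatrixCBF.IsExtClassK (α i) ∧ ContDiff ℝ ∞ (α i))
    -- the input does not enter the derivatives of `Ψ₁, …, Ψ_{r-1}`
    (hlevel : ∀ i, 1 ≤ i → i < r → ∀ (j : Fin m) (x : MatrixCBF.E n),
      MatrixCBF.lieDeriv (MatrixCBF.col g j) (MatrixCBF.Psi f H α i) x = 0)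
    -- matrix relative degree `r` on a neighborhood of the critical part of the boundary
    (hdeg : ∃ U : Set (MatrixCBF.E n), IsOpen U ∧
      MatrixCBF.criticalBoundary f H α r ⊆ U ∧
      ∀ x ∈ U, MatrixCBF.HasMatrixRelDegAt f g H α r x) :
    MatrixCBF.IsODHOMCBF f g H α r ∧
    (∃ k : MatrixCBF.E n → MatrixCBF.E m, Continuous k ∧
      MatrixCBF.ForwardInvariant (MatrixCBF.closedLoop f g k)
        (MatrixCBF.safeInter f H α r)) ∧
    -- the safety filter is such a feedback
    (∀ a : ℝ → ℝ, MatrixCBF.IsExtClassK a → MatrixCBF.ODCondition f g H α r a →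
      ∀ (knom : MatrixCBF.E n → MatrixCBF.E m) (c θ : ℝ), Continuous knom → 0 < c →
        ∃ (W : Set (MatrixCBF.E n)) (k : MatrixCBF.E n → MatrixCBF.E m),
          IsOpen W ∧ MatrixCBF.safeInter f H α r ⊆ W ∧ Continuous k ∧
          (∀ x ∈ W, ∃ w : ℝ,
            MatrixCBF.IsSDPSolution f g H α r a knom c θ x (k x, w) ∧
            ∀ z, MatrixCBF.IsSDPSolution f g H α r a knom c θ x z → z = (k x, w)) ∧
          MatrixCBF.ForwardInvariant (MatrixCBF.closedLoop f g k)
            (MatrixCBF.safeInter f H α r)) := by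
  have hdeg' : ∀ x ∈ MatrixCBF.criticalBoundary f H α r,
      ∃ (q : ℕ) (V : Matrix (Fin p) (Fin q) ℝ),
        MatrixCBF.IsMinEigenbasis (MatrixCBF.Psi f H α r x) V ∧ ∃ u : MatrixCBF.E m,
          (Vᵀ * (∑ j, u j • MatrixCBF.lieDeriv (MatrixCBF.col g j)
            (MatrixCBF.Psi f H α r) x) * V).PosDef := by
    obtain ⟨U, -, hU, hUdeg⟩ := hdeg
    intro x hx
    obtain ⟨-, q, V, hV, u, hu⟩ := hUdeg x (hU hx)
    refine ⟨q, V, hV, u, ?_⟩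
    simpa only [MatrixCBF.lieDeriv_col_Psi_eq hf hH hsymm hr (fun i h1 h2 => (hα i h1 h2).2)
      hlevel] using hu
  have hod := MatrixCBF.ODCondition_id hsymm hr hdeg'
  refine ⟨⟨id, MatrixCBF.isExtClassK_id, hod⟩, ?_, fun a ha hoda knom c θ hk hc =>
    MatrixCBF.exists_safety_filter hf hg hH hsymm hr hα hlevel ha hoda θ hk hc⟩
  -- Any admissible data would do; the filter is taken with zero nominal input, `c = 1` and `θ = 0`.
  obtain ⟨W, k, -, -, hk, -, hinv⟩ := MatrixCBF.exists_safety_filter hf hg hH hsymm hr hα hlevel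
    MatrixCBF.isExtClassK_id hod (knom := fun _ => 0) 0 continuous_const one_pos
  exact ⟨k, hk, hinv⟩
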